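/- Let $0\le n\le k$ and $N=2k+n$. Standard tableaux of shape $(n,k,k)$ have rows of lengths $n,k,k$ from top to bottom, are filled bijectively with $1,\dots,N$, and increase from left to right along rows and from bottom to top along columns. The *$\mathsf m$-diagram* of such a tableau $T$ consists of a horizontal line with points $1,\dots,N$ and semicircular arcs above it: for $i=1,2,\dots,N$ in turn, if $i$ is not on the bottom row, join $i$ to the largest $j<i$ on the row immediately below that of $i$ that is not yet joined to a number on the row of $i$. Arcs between the bottom and middle rows are *first arcs*, those between the middle and top rows *second arcs*. The *resolved $\mathsf m$-diagram* $W(T)$ is the directed plane graph obtained as follows. Each boundary point lying on two arcs is replaced by a $Y$, with a stem from that boundary point to a trivalent vertex at which the two arcs end. Edges of two joined arcs and their stem are directed away from the boundary towards that trivalent vertex, and a first arc not joined to a second arc is directed from its bottom-row endpoint to its middle-row endpoint; directions continue through crossings. Each crossing of two arcs is replaced by two trivalent vertices, $v_1$ receiving the two incoming edges and $v_2$ emitting the two outgoing edges, with a new edge $v_2\to v_1$. A *web* (for $\mathfrak{sl}_3$) is a finite directed plane graph above a boundary line whose boundary vertices have degree one, whose interior vertices are trivalent, and each of whose vertices is a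 source or a sink. It is *irreducible* if each interior face (a face containing no segment of the boundary line on its boundary) has at least six edges on its boundary. Webs are considered up to isotopy fixing the boundary line. The *depth* $d(f)$ of a face $f$ is the minimal number of edges crossed by a path from $f$ to the unbounded face that does not cross the boundary line. For a boundary vertex $i$ let $\delta(i)=d(i^+)-d(i^-)$, where $i^+$ and $i^-$ are the faces immediately to the right and left of $i$. The *extended depth map* puts $i$ on the bottom row if $\delta(i)=1$, on the middle row if $\delta(i)=0$, or if $\delta(i)=-1$ and $i$ is a sink, and on the top row if $\delta(i)=-1$ and $i$ is a source; rows are written in increasing order. Then, for every standard tableau $T$ of shape $(n,k,k)$, $W(T)$ is an irreducible web, whose boundary has $3n+(k-n)$ sources and $k-n$ sinks. The extended depth map $D$ is well defined on the set of irreducible webs that are resolved $\mathsf m$-diagrams of standard tableaux of shape $(n,k,k)$: it sends each of them to a unique standard tableau of shape $(n,k,k)$. On these webs it is the two-sided inverse of $W$: $D(W(T))=T$ for every standard tableau $T$ of shape $(n,k,k)$, and $W(D(G))=G$ up to isotopy for every web $G$ in this set. -/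

import Mathlib

/-! ### Standard tableaux of shape `(n, k, k)` -/

/-- A standard tableau of shape `μ`: the boxes are filled bijectively with the numbers
`1, 2, …, N` (represented by `Fin N`, `N` being the number of boxes), increasing along rows and
along columns.  Row `0` is the longest row; it is the *bottom* row when tableaux are drawn with
columns increasing from bottom to top. -/
structure StandardTableau (μ : YoungDiagram) where
  entry : μ.cells ≃ Fin μ.card
  row_lt : ∀ c d : μ.cells, c.1.1 = d.1.1 → c.1.2 < d.1.2 → entry c < entry d
  col_lt : ∀ c d : μ.cells, c.1.2 = d.1.2 → c.1.1 < d.1.1 → entry c < entry d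

/-- The three-row shape with `n` boxes in the top row (row `2`) and `k` boxes in each of the
middle row (row `1`) and the bottom row (row `0`). -/
def shapeNKK (n k : ℕ) (h : n ≤ k) : YoungDiagram :=
  YoungDiagram.ofRowLens [k, k, n] (by
    rw [List.sortedGE_iff_pairwise]; simp [h])

/-- The row (counted from the bottom, starting with `0`) that contains the number `i`. -/
def StandardTableau.row {μ : YoungDiagram} (T : StandardTableau μ) (i : Fin μ.card) : ℕ :=
  (T.entry.symm i).1.1

/-! ### Plane graphs in the upper half plane

A graph drawn above a horizontal boundary line (that is, in a disk whose boundary circle is cut at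
a point `∞`) is encoded up to isotopy by its half-edges, the counterclockwise rotation of the
half-edges about each vertex, and the matching of half-edges into edges. -/

/-- The raw data of a directed graph in the upper half plane with the `N` boundary vertices
`1, …, N` (indexed by `Fin N`, from left to right), each carrying one half-edge. -/
structure BoundaryGraph (N : ℕ) where
  /-- the half-edges: pairs of a vertex and an end of an edge at that vertex -/
  HalfEdge : Type
  /-- the next half-edge about the same vertex, counterclockwise -/
  rot : HalfEdge → HalfEdge
  /-- the two half-edges form an edge -/
  opp : HalfEdge → HalfEdge → Prop
  /-- the half-edge at the `i`-th boundary vertex -/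
  bdry : Fin N → HalfEdge
  /-- the edge is directed away from the vertex of this half-edge -/
  out : HalfEdge → Prop

namespace BoundaryGraph

variable {N : ℕ}

/-- Half-edges of the graph together with those of the boundary line.  With the boundary vertices
in positions `1, …, N` and the point `∞` in the positions `0` and `N + 1`, the boundary line
consists of the segments `s_0, …, s_N`, where `s_p` joins position `p` to position `p + 1`;
`(p, false)` is the half-edge of `s_p` at its left end and `(p, true)` that at its right end. -/
abbrev Dart (G : BoundaryGraph N) : Type := G.HalfEdge ⊕ (Fin (N + 1) × Bool)

/-- `RotStep d e`: the dart `e` follows `d` counterclockwise about their common vertex.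
About a boundary vertex the order is: right along the line, up into the graph, left along the
line. -/
inductive RotStep (G : BoundaryGraph N) : G.Dart → G.Dart → Prop
  | inner (h : G.HalfEdge) (hh : ∀ i, h ≠ G.bdry i) : RotStep G (Sum.inl h) (Sum.inl (G.rot h))
  | up (i : Fin N) : RotStep G (Sum.inl (G.bdry i)) (Sum.inr (i.castSucc, true))
  | left (i : Fin N) : RotStep G (Sum.inr (i.castSucc, true)) (Sum.inr (i.succ, false))
  | right (i : Fin N) : RotStep G (Sum.inr (i.succ, false)) (Sum.inl (G.bdry i))
  | inftyFirst : RotStep G (Sum.inr (0, false)) (Sum.inr (Fin.last N, true))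
  | inftyLast : RotStep G (Sum.inr (Fin.last N, true)) (Sum.inr (0, false))

/-- `Link d e`: the darts `d` and `e` are the two halves of one edge or boundary segment. -/
inductive Link (G : BoundaryGraph N) : G.Dart → G.Dart → Prop
  | edge (h h' : G.HalfEdge) (hh : G.opp h h') : Link G (Sum.inl h) (Sum.inl h')
  | segment (p : Fin (N + 1)) (b : Bool) : Link G (Sum.inr (p, b)) (Sum.inr (p, !b))

/-- Walking along the edge of `d` with the face on the left-hand side, the next edge on the
boundary of that face is the edge of `d'`: one arrives through the other half `e` of the edge and
leaves through the dart that precedes `e` counterclockwise. -/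
def FaceStep (G : BoundaryGraph N) (d d' : G.Dart) : Prop :=
  ∃ e, G.Link d e ∧ G.RotStep d' e

/-- The vertices, including the boundary vertices and `∞`. -/
def Vertex (G : BoundaryGraph N) : Type := Quot G.RotStep

/-- The edges, including the segments of the boundary line. -/
def Edge (G : BoundaryGraph N) : Type := Quot G.Link

/-- The faces, including the one on the other side of the boundary line. -/
def Face (G : BoundaryGraph N) : Type := Quot G.FaceStep

/-- The face to the left of a dart, seen from its vertex. -/
def face (G : BoundaryGraph N) (d : G.Dart) : G.Face := Quot.mk _ d

/-- A web for `sl₃`: a finite directed plane graph above the boundary line such that boundary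
vertices have degree one, all other vertices are trivalent, and each vertex is a source or a
sink.  Planarity is expressed by connectedness of the graph together with the boundary line and
Euler's formula `V - E + F = 2`.  (Every component of a non-elliptic web reaches the boundary, so
connectedness together with the boundary line is no restriction for these.) -/
structure IsWeb (G : BoundaryGraph N) : Prop where
  finite : Finite G.HalfEdge
  opp_symm : ∀ h h', G.opp h h' → G.opp h' h
  opp_ne : ∀ h h', G.opp h h' → h ≠ h'
  opp_unique : ∀ h, ∃! h', G.opp h h'
  bdry_injective : Function.Injective G.bdry
  univalent : ∀ i, G.rot (G.bdry i) = G.bdry i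
  trivalent : ∀ h, (∀ i, h ≠ G.bdry i) → G.rot h ≠ h ∧ G.rot (G.rot (G.rot h)) = h
  directed : ∀ h h', G.opp h h' → (G.out h ↔ ¬ G.out h')
  source_or_sink : ∀ h, G.out (G.rot h) ↔ G.out h
  connected : ∀ d e : G.Dart, Relation.EqvGen (fun x y => G.RotStep x y ∨ G.Link x y) d e
  euler : Nat.card G.Vertex + Nat.card G.Face = Nat.card G.Edge + 2

/-- A face is interior if no segment of the boundary line lies on its boundary. -/
def IsInteriorFace (G : BoundaryGraph N) (f : G.Face) : Prop :=
  ∀ p : Fin (N + 1) × Bool, G.face (Sum.inr p) ≠ f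

/-- An irreducible (that is, reduced or non-elliptic) web: each interior face has at least six
edges on its boundary. -/
structure IsIrreducibleWeb (G : BoundaryGraph N) : Prop where
  isWeb : G.IsWeb
  nonelliptic : ∀ f : G.Face, G.IsInteriorFace f → 6 ≤ Nat.card {d : G.Dart // G.face d = f}

/-- The `i`-th boundary vertex is a source; otherwise it is a sink. -/
def IsSource (G : BoundaryGraph N) (i : Fin N) : Prop := G.out (G.bdry i)

/-- Two graphs are the same (up to isotopy of the upper half plane fixing the boundary line) if
there is a bijection of half-edges that preserves all the structure. -/
def Isotopic (G G' : BoundaryGraph N) : Prop :=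
  ∃ e : G.HalfEdge ≃ G'.HalfEdge,
    (∀ h, e (G.rot h) = G'.rot (e h)) ∧ (∀ h h', G.opp h h' ↔ G'.opp (e h) (e h')) ∧
      (∀ i, e (G.bdry i) = G'.bdry i) ∧ ∀ h, G.out h ↔ G'.out (e h)

/-- The dual graph: two distinct faces are adjacent if an edge of the graph (not a segment of the
boundary line) separates them. -/
def dualGraph (G : BoundaryGraph N) : SimpleGraph G.Face :=
  SimpleGraph.fromRel fun f g =>
    ∃ h h', G.opp h h' ∧ G.face (Sum.inl h) = f ∧ G.face (Sum.inl h') = g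

/-- The unbounded face above the boundary line. -/
def unboundedFace (G : BoundaryGraph N) : G.Face := G.face (Sum.inr (0, false))

/-- Path depth: the least number of edges crossed by a path to the unbounded face that does not
cross the boundary line. -/
noncomputable def depth (G : BoundaryGraph N) (f : G.Face) : ℕ := G.dualGraph.dist f G.unboundedFace

/-- The face immediately to the left of the `i`-th boundary vertex. -/
def faceLeft (G : BoundaryGraph N) (i : Fin N) : G.Face := G.face (Sum.inl (G.bdry i))

/-- The face immediately to the right of the `i`-th boundary vertex. -/
def faceRight (G : BoundaryGraph N) (i : Fin N) : G.Face := G.face (Sum.inr (i.succ, false))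

open Classical in
/-- The row in which the extended depth map puts `i` (bottom `0`, middle `1`, top `2`), if any. -/
noncomputable def extendedDepthRow (G : BoundaryGraph N) (i : Fin N) : Option ℕ :=
  let δ : ℤ := (G.depth (G.faceRight i) : ℤ) - (G.depth (G.faceLeft i) : ℤ)
  if δ = 1 then some 0
  else if δ = 0 then some 1
  else if δ = -1 then (if G.IsSource i then some 2 else some 1)
  else none

/-- `T` is the standard tableau that the extended depth map creates from `G`: each boundary vertex
`i` lies in the row of `T` prescribed by the depth change at `i`. -/
def IsExtendedDepthTableau {μ : YoungDiagram} (G : BoundaryGraph μ.card)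
    (T : StandardTableau μ) : Prop :=
  ∀ i, G.extendedDepthRow i = some (T.row i)

end BoundaryGraph

/-! ### The `m`-diagram of a standard tableau -/

namespace StandardTableau

variable {μ : YoungDiagram}

open Classical in
/-- The number `j < i` to which `i` is joined by an arc when the numbers `i = 1, …, N` are treated
in increasing order: the largest `j < i` on the row immediately below that of `i` which is not
already on an arc to a number on the same row as `i`; `⊥` if there is none. -/
noncomputable def partner (T : StandardTableau μ) (i : Fin μ.card) : WithBot (Fin μ.card) :=
  (Finset.univ.filter fun j : Fin μ.card =>
    T.row j + 1 = T.row i ∧ j < i ∧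
      ∀ i' : {x : Fin μ.card // x < i}, T.row i' = T.row i →
        T.partner i' ≠ (j : WithBot (Fin μ.card))).max
termination_by i
decreasing_by all_goals exact (fun x : {x : Fin μ.card // x < i} => x.2) _

/-- The arcs `(j, i)`, `j < i`, between row `r` and row `r + 1`.  In a three-row tableau
`T.Arc 0` are the first arcs and `T.Arc 1` the second arcs. -/
abbrev Arc (T : StandardTableau μ) (r : ℕ) : Type :=
  {p : Fin μ.card × Fin μ.card // T.row p.2 = r + 1 ∧ T.partner p.2 = (p.1 : WithBot (Fin μ.card))}

/-- The left endpoint of an arc. -/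
def Arc.left {T : StandardTableau μ} {r : ℕ} (a : T.Arc r) : Fin μ.card := a.1.1

/-- The right endpoint of an arc. -/
def Arc.right {T : StandardTableau μ} {r : ℕ} (a : T.Arc r) : Fin μ.card := a.1.2

/-- The crossings of a first arc with a second arc: two semicircles cross exactly when their
endpoints interlace.  (Arcs of the same kind never cross.) -/
abbrev Crossing (T : StandardTableau μ) : Type :=
  {c : T.Arc 0 × T.Arc 1 //
    (Arc.left c.2 < Arc.left c.1 ∧ Arc.left c.1 < Arc.right c.2 ∧ Arc.right c.2 < Arc.right c.1) ∨
    (Arc.left c.1 < Arc.left c.2 ∧ Arc.left c.2 < Arc.right c.1 ∧ Arc.right c.1 < Arc.right c.2)}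

/-- The first arc through a crossing. -/
def Crossing.fst {T : StandardTableau μ} (c : T.Crossing) : T.Arc 0 := c.1.1

/-- The second arc through a crossing. -/
def Crossing.snd {T : StandardTableau μ} (c : T.Crossing) : T.Arc 1 := c.1.2

/-- The position of a crossing along its first arc, given by the endpoint of the second arc that
lies beneath the first arc.  The second arcs do not cross one another, so this orders the
crossings on a first arc from left to right, as the `x`-coordinates of the intersection points of
the semicircles do. -/
def Crossing.posFst {T : StandardTableau μ} (c : T.Crossing) : Fin μ.card :=
  if Arc.left c.fst < Arc.left c.snd then Arc.left c.snd else Arc.right c.snd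

/-- The position of a crossing along its second arc, given by the endpoint of the first arc that
lies beneath the second arc. -/
def Crossing.posSnd {T : StandardTableau μ} (c : T.Crossing) : Fin μ.card :=
  if Arc.left c.fst < Arc.left c.snd then Arc.right c.fst else Arc.left c.fst

/-! ### The resolved `m`-diagram -/

/-- The interior vertices of the resolved diagram: for every second arc `b` the trivalent vertex of
the `Y` above the left endpoint of `b` (the middle vertex of the `m` that contains `b`), and for
every crossing the two vertices that replace it, one receiving the two incoming edges and one
emitting the two outgoing edges. -/
inductive InnerVertex (T : StandardTableau μ) : Type
  | tri (b : T.Arc 1)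
  | sink (c : T.Crossing)
  | source (c : T.Crossing)

/-- The three edge ends at an interior vertex: the one on the first arc, the one on the second arc,
and the third one (the stem of a `Y`, or the edge between the two vertices of a resolved
crossing). -/
inductive Slot : Type
  | first
  | second
  | third

/-- The half-edges of the resolved diagram: one at each boundary vertex, three at each interior
vertex. -/
abbrev ResolvedHalfEdge (T : StandardTableau μ) : Type := Fin μ.card ⊕ (T.InnerVertex × Slot)

/-- The rotation `first → second → third → first`. -/
def Slot.next : Slot → Slot
  | first => second
  | second => third
  | third => first

/-- The rotation `second → first → third → second`. -/
def Slot.prev : Slot → Slot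
  | first => third
  | third => second
  | second => first

/-- Counterclockwise rotation at a vertex of a resolved crossing.  The new edge is vertical.  If the
first arc starts to the left of the second arc, both arcs are directed downwards into the crossing
(first arc from the left, second arc from the right), so that the incoming ends are above the
outgoing ends; otherwise they are directed upwards into the crossing. -/
def crossingRot {T : StandardTableau μ} (c : T.Crossing) (s : Slot) : Slot :=
  if Arc.left c.fst < Arc.left c.snd then s.prev else s.next

/-- Counterclockwise rotation of the half-edges.  At the vertex of a `Y` the second arc leaves to the
right, the first arc to the left, and the stem points down. -/
def resolvedRot (T : StandardTableau μ) : T.ResolvedHalfEdge → T.ResolvedHalfEdge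
  | Sum.inl i => Sum.inl i
  | Sum.inr (InnerVertex.tri b, s) => Sum.inr (InnerVertex.tri b, s.prev)
  | Sum.inr (InnerVertex.sink c, s) => Sum.inr (InnerVertex.sink c, crossingRot c s)
  | Sum.inr (InnerVertex.source c, s) => Sum.inr (InnerVertex.source c, crossingRot c s)

/-- `h` is a half-edge at position `t` of the first arc `a` from which an edge of `a` departs.
First arcs are directed from left to right. -/
inductive FstOut (T : StandardTableau μ) (a : T.Arc 0) : T.ResolvedHalfEdge → Fin μ.card → Prop
  | start : FstOut T a (Sum.inl (Arc.left a)) (Arc.left a)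
  | cross (c : T.Crossing) (hc : c.fst = a) :
      FstOut T a (Sum.inr (InnerVertex.source c, Slot.first)) c.posFst

/-- `h` is a half-edge at position `t` of the first arc `a` at which an edge of `a` arrives.  The
arc ends at the vertex of the `Y` if it belongs to an `m`, and at the boundary vertex if it is
isolated. -/
inductive FstIn (T : StandardTableau μ) (a : T.Arc 0) : T.ResolvedHalfEdge → Fin μ.card → Prop
  | cross (c : T.Crossing) (hc : c.fst = a) :
      FstIn T a (Sum.inr (InnerVertex.sink c, Slot.first)) c.posFst
  | endTri (b : T.Arc 1) (hb : Arc.left b = Arc.right a) :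
      FstIn T a (Sum.inr (InnerVertex.tri b, Slot.first)) (Arc.right a)
  | endBdry (hb : ∀ b : T.Arc 1, Arc.left b ≠ Arc.right a) :
      FstIn T a (Sum.inl (Arc.right a)) (Arc.right a)

/-- `h` is a half-edge at position `t` of the second arc `b` from which an edge of `b` departs.
Second arcs are directed from right to left. -/
inductive SndOut (T : StandardTableau μ) (b : T.Arc 1) : T.ResolvedHalfEdge → Fin μ.card → Prop
  | start : SndOut T b (Sum.inl (Arc.right b)) (Arc.right b)
  | cross (c : T.Crossing) (hc : c.snd = b) :
      SndOut T b (Sum.inr (InnerVertex.source c, Slot.second)) c.posSnd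

/-- `h` is a half-edge at position `t` of the second arc `b` at which an edge of `b` arrives. -/
inductive SndIn (T : StandardTableau μ) (b : T.Arc 1) : T.ResolvedHalfEdge → Fin μ.card → Prop
  | cross (c : T.Crossing) (hc : c.snd = b) :
      SndIn T b (Sum.inr (InnerVertex.sink c, Slot.second)) c.posSnd
  | endTri : SndIn T b (Sum.inr (InnerVertex.tri b, Slot.second)) (Arc.left b)

/-- `ResolvedEdge h h'`: the resolved diagram has an edge directed from the vertex of `h` to the
vertex of `h'`, with the half-edges `h` and `h'`. -/
inductive ResolvedEdge (T : StandardTableau μ) : T.ResolvedHalfEdge → T.ResolvedHalfEdge → Prop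
  /-- the piece of a first arc between two consecutive points on it -/
  | alongFst (a : T.Arc 0) (h h' : T.ResolvedHalfEdge) (t t' : Fin μ.card)
      (hout : T.FstOut a h t) (hin : T.FstIn a h' t') (hlt : t < t')
      (hcons : ∀ c : T.Crossing, c.fst = a → ¬ (t < c.posFst ∧ c.posFst < t')) :
      ResolvedEdge T h h'
  /-- the piece of a second arc between two consecutive points on it -/
  | alongSnd (b : T.Arc 1) (h h' : T.ResolvedHalfEdge) (t t' : Fin μ.card)
      (hout : T.SndOut b h t) (hin : T.SndIn b h' t') (hlt : t' < t)
      (hcons : ∀ c : T.Crossing, c.snd = b → ¬ (t' < c.posSnd ∧ c.posSnd < t)) :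
      ResolvedEdge T h h'
  /-- the stem of a `Y` -/
  | stem (b : T.Arc 1) :
      ResolvedEdge T (Sum.inl (Arc.left b)) (Sum.inr (InnerVertex.tri b, Slot.third))
  /-- the edge added when a crossing is resolved -/
  | resolve (c : T.Crossing) :
      ResolvedEdge T (Sum.inr (InnerVertex.source c, Slot.third))
        (Sum.inr (InnerVertex.sink c, Slot.third))

/-- The half-edges at which the edge is directed away from the vertex: those at the vertices
emitting the outgoing edges of a crossing, and those at boundary vertices, except the right
endpoints of isolated first arcs. -/
def ResolvedOut (T : StandardTableau μ) : T.ResolvedHalfEdge → Prop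
  | Sum.inl i => T.row i = 1 → ∃ b : T.Arc 1, Arc.left b = i
  | Sum.inr (InnerVertex.tri _, _) => False
  | Sum.inr (InnerVertex.sink _, _) => False
  | Sum.inr (InnerVertex.source _, _) => True

/-- The resolved `m`-diagram of a three-row standard tableau. -/
def resolvedMDiagram (T : StandardTableau μ) : BoundaryGraph μ.card where
  HalfEdge := T.ResolvedHalfEdge
  rot := T.resolvedRot
  opp h h' := T.ResolvedEdge h h' ∨ T.ResolvedEdge h' h
  bdry i := Sum.inl i
  out := T.ResolvedOut

end StandardTableau

/-! Every face of the diagram above the boundary line lies under a definite set of first arcs and a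
definite set of second arcs. This pair of sets, the label, is read locally at a dart and is
unchanged by a step around a face (`label_of_faceStep`), so it is an invariant of faces. The whole
theorem rests on it.

Planarity. For a connected rotation system `V + F ≤ E + 2`; a linear-algebra form of this is
`card_vertices_edges_faces_le`. In the opposite direction, the face below the line, the unbounded
face, the face under the highest part of each arc and the face under each crossing have pairwise
different labels (`peakLabel_injective`). This bounds `F` from below by the number needed, so
Euler's formula holds and there are no other faces (`euler_and_card_face`, `peakFace_bijective`).
Thus labels replace any argument about curves in the plane.

Depth. Crossing an edge changes the number of arcs overhead by at most one: stems and new edges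
preserve it, pieces of arcs change it by exactly one. Since the list of faces is complete, each
bounded face has a piece of an arc on its upper side, and crossing it lowers the count. Hence depth
is the number of arcs overhead (`depth_eq`). At a boundary point it changes by `1` on the bottom
row, by `0` at the middle of an `m`, and by `-1` at the end of an isolated first arc or on the top
row. The last two are told apart as sink and source, so the rows, and with them the tableau, are
recovered.

Irreducibility. A walk around an interior face, starting at the new edge of a crossing at its left
end, runs along its lower side, over a new edge at its right end and back along its upper side.
First and second arcs alternate along each side, two arcs cross at most once, and the orientation of
a crossing limits which arcs can lead into its ends. So the walk cannot close up in fewer than six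
steps (`WestEnd.exists_five_steps`). -/

/-! ### The genus inequality -/

section Genus

variable {D : Type*}

/-- The combinatorial genus inequality: for a rotation `σ` and a fixed involution `α` generating a
transitive group, the numbers of vertices, edges and faces satisfy `V + E + F ≤ |D| + 2`. -/
theorem card_vertices_edges_faces_le [Finite D] (σ α : Equiv.Perm D) (hα : ∀ d, α (α d) = d)
    (hc : ∀ d e, Relation.EqvGen (fun x y => σ x = y ∨ α x = y) d e) :
    Nat.card (Quot fun x y => σ x = y) + Nat.card (Quot fun x y => α x = y) +
      Nat.card (Quot fun x y => σ y = α x) ≤ Nat.card D + 2 := by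
  classical
  cases isEmpty_or_nonempty D with
  | inl h => simp
  | inr hD =>
  obtain ⟨d₀⟩ := hD
  have := Fintype.ofFinite D
  have h1 : Finite (Quot fun x y => σ x = y) := Quot.finite _
  have h2 : Finite (Quot fun x y => α x = y) := Quot.finite _
  have h3 : Finite (Quot fun x y => σ y = α x) := Quot.finite _
  have := Fintype.ofFinite (Quot fun x y => σ x = y)
  have := Fintype.ofFinite (Quot fun x y => α x = y)
  have := Fintype.ofFinite (Quot fun x y => σ y = α x)
  -- Functions on vertices, edges and faces are sent to one function on darts, plus two normalizing
  -- values. Injectivity of `L` is the claimed inequality of dimensions.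
  let L : ((Quot fun x y => σ x = y) → ℚ) × ((Quot fun x y => α x = y) → ℚ) ×
      ((Quot fun x y => σ y = α x) → ℚ) →ₗ[ℚ] (D → ℚ) × ℚ × ℚ :=
    { toFun := fun w => (fun d => (w.1 (Quot.mk _ (α d)) - w.1 (Quot.mk _ d)) + w.2.1 (Quot.mk _ d) +
        (w.2.2 (Quot.mk _ d) - w.2.2 (Quot.mk _ (α d))), w.1 (Quot.mk _ d₀), w.2.2 (Quot.mk _ d₀))
      map_add' := by
        intro x y
        ext <;> simp
        ring
      map_smul' := by
        intro x y
        ext <;> simp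
        ring }
  have hinj : Function.Injective L := by
    rw [← LinearMap.ker_eq_bot, LinearMap.ker_eq_bot']
    rintro ⟨f, g, h⟩ hL
    have hL0 : ∀ d, (f (Quot.mk _ (α d)) - f (Quot.mk _ d)) + g (Quot.mk _ d) +
        (h (Quot.mk _ d) - h (Quot.mk _ (α d))) = 0 := fun d => congrFun (congrArg Prod.fst hL) d
    have hf0 : f (Quot.mk _ d₀) = 0 := congrArg (fun w => w.2.1) hL
    have hh0 : h (Quot.mk _ d₀) = 0 := congrArg (fun w => w.2.2) hL
    have hσf : ∀ d, f (Quot.mk _ (σ d)) = f (Quot.mk _ d) := fun d =>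
      congrArg f (Quot.sound (r := fun x y => σ x = y) rfl).symm
    have hαg : ∀ d, g (Quot.mk _ (α d)) = g (Quot.mk _ d) := fun d =>
      congrArg g (Quot.sound (r := fun x y => α x = y) rfl).symm
    have hφh : ∀ d, h (Quot.mk _ (α (σ d))) = h (Quot.mk _ d) := fun d =>
      congrArg h (Quot.sound (r := fun x y => σ y = α x) (hα _).symm)
    -- The edge term is symmetric under `α` and the other two are antisymmetric, so both parts
    -- vanish separately.
    have hg : ∀ d, g (Quot.mk _ d) = 0 := by
      intro d
      have e1 := hL0 d
      have e2 := hL0 (α d)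
      rw [hα, hαg] at e2
      linarith
    have hu : ∀ d, f (Quot.mk _ (α d)) - f (Quot.mk _ d) =
        -(h (Quot.mk _ d) - h (Quot.mk _ (α d))) := by
      intro d
      have e1 := hL0 d
      have e2 := hg d
      linarith
    -- Reindexing by `d ↦ α (σ d)`: `f` is constant around vertices and `h` around faces.
    have hP : ∑ d, f (Quot.mk _ (α d)) * h (Quot.mk _ d) =
        ∑ d, f (Quot.mk _ d) * h (Quot.mk _ d) := by
      rw [← Equiv.sum_comp (σ.trans α) fun d => f (Quot.mk _ (α d)) * h (Quot.mk _ d)]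
      refine Finset.sum_congr rfl fun d _ => ?_
      simp only [Equiv.trans_apply, hα, hσf, hφh]
    have hP' : ∑ d, f (Quot.mk _ d) * h (Quot.mk _ (α d)) =
        ∑ d, f (Quot.mk _ (α d)) * h (Quot.mk _ d) := by
      rw [← Equiv.sum_comp α]
      simp only [hα]
    have hQ' : ∑ d, f (Quot.mk _ (α d)) * h (Quot.mk _ (α d)) =
        ∑ d, f (Quot.mk _ d) * h (Quot.mk _ d) :=
      Equiv.sum_comp α fun d => f (Quot.mk _ d) * h (Quot.mk _ d)
    -- By `hu`, a discrete Cauchy–Riemann equation, the energy of `f` is the sum of the products of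
    -- the differences of `f` and `h`. The summations by parts above make that sum zero, so `f` is
    -- also constant across edges, and hence so is `h`.
    have hsq : ∑ d, (f (Quot.mk _ (α d)) - f (Quot.mk _ d)) ^ 2 = 0 := by
      have : ∀ d, (f (Quot.mk _ (α d)) - f (Quot.mk _ d)) ^ 2 =
          f (Quot.mk _ (α d)) * h (Quot.mk _ (α d)) + f (Quot.mk _ d) * h (Quot.mk _ d) -
          f (Quot.mk _ (α d)) * h (Quot.mk _ d) - f (Quot.mk _ d) * h (Quot.mk _ (α d)) := by
        intro d
        have := hu d
        rw [sq]
        nth_rewrite 2 [this]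
        ring
      simp only [this, Finset.sum_sub_distrib, Finset.sum_add_distrib, hP, hP', hQ']
      ring
    have hfα : ∀ d, f (Quot.mk _ (α d)) = f (Quot.mk _ d) := by
      intro d
      have := (Finset.sum_eq_zero_iff_of_nonneg fun d _ => sq_nonneg _).1 hsq d (Finset.mem_univ d)
      have := pow_eq_zero_iff (two_ne_zero) |>.1 this
      linarith
    have hhα : ∀ d, h (Quot.mk _ (α d)) = h (Quot.mk _ d) := by
      intro d
      have := hu d
      have := hfα d
      linarith
    have hhσ : ∀ d, h (Quot.mk _ (σ d)) = h (Quot.mk _ d) := by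
      intro d
      rw [← hφh d, hhα]
    have hconst : ∀ d e, f (Quot.mk _ d) = f (Quot.mk _ e) ∧ h (Quot.mk _ d) = h (Quot.mk _ e) := by
      intro d e
      induction hc d e with
      | rel x y hxy =>
        rcases hxy with rfl | rfl
        · exact ⟨(hσf _).symm, (hhσ _).symm⟩
        · exact ⟨(hfα _).symm, (hhα _).symm⟩
      | refl x => exact ⟨rfl, rfl⟩
      | symm x y _ ih => exact ⟨ih.1.symm, ih.2.symm⟩
      | trans x y z _ _ ih1 ih2 => exact ⟨ih1.1.trans ih2.1, ih1.2.trans ih2.2⟩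
    refine Prod.ext ?_ (Prod.ext ?_ ?_)
    · funext q
      induction q using Quot.ind with
      | mk d => exact (hconst d d₀).1.trans hf0
    · funext q
      induction q using Quot.ind with
      | mk d => exact hg d
    · funext q
      induction q using Quot.ind with
      | mk d => exact (hconst d d₀).2.trans hh0
  have := LinearMap.finrank_le_finrank_of_injective hinj
  simp only [Module.finrank_prod, Module.finrank_fintype_fun_eq_card, Module.finrank_self] at this
  simp only [Nat.card_eq_fintype_card]
  omega

/-- The orbits of a fixed-point-free involution have two elements each. -/
theorem card_eq_two_mul_card_quot [Finite D] (α : Equiv.Perm D) (hα : ∀ d, α (α d) = d)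
    (hne : ∀ d, α d ≠ d) : Nat.card D = 2 * Nat.card (Quot fun x y => α x = y) := by
  classical
  have h2 : Finite (Quot fun x y => α x = y) := Quot.finite _
  have := Fintype.ofFinite D
  have := Fintype.ofFinite (Quot fun x y => α x = y)
  rw [Nat.card_eq_fintype_card, Nat.card_eq_fintype_card, ← Finset.card_univ,
    Finset.card_eq_sum_card_fiberwise (f := Quot.mk fun x y => α x = y) (t := Finset.univ)
      (fun _ _ => Finset.mem_coe.2 (Finset.mem_univ _)),
    Finset.sum_const_nat (m := 2), Finset.card_univ, mul_comm]
  have key : ∀ d e, Relation.EqvGen (fun x y => α x = y) e d → e = d ∨ e = α d := by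
    intro d e h
    induction h with
    | rel x y hxy => exact Or.inr (by rw [← hxy, hα])
    | refl x => exact Or.inl rfl
    | symm x y _ ih =>
      rcases ih with rfl | rfl
      · exact Or.inl rfl
      · exact Or.inr (hα _).symm
    | trans x y z _ _ ih1 ih2 =>
      rcases ih1 with rfl | rfl
      · exact ih2
      · rcases ih2 with rfl | rfl
        · exact Or.inr rfl
        · exact Or.inl (hα _)
  intro q _
  induction q using Quot.ind with
  | mk d =>
    have : (Finset.univ.filter fun e => (Quot.mk (fun x y => α x = y) e) = Quot.mk _ d) =
        {d, α d} := by
      ext e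
      simp only [Finset.mem_filter, Finset.mem_univ, true_and, Finset.mem_insert,
        Finset.mem_singleton]
      constructor
      · exact fun h => key _ _ (Quot.eqvGen_exact h)
      · rintro (rfl | rfl)
        · rfl
        · exact (Quot.sound (r := fun x y => α x = y) rfl).symm
    rw [this, Finset.card_pair (hne d).symm]

end Genus

/-! ### The darts of a boundary graph as a combinatorial map -/

namespace BoundaryGraph

variable {N : ℕ}

/-- The local conditions in the definition of a web that make its darts a combinatorial map. -/
structure IsMap (G : BoundaryGraph N) : Prop where
  finite : Finite G.HalfEdge
  opp_symm : ∀ h h', G.opp h h' → G.opp h' h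
  opp_ne : ∀ h h', G.opp h h' → h ≠ h'
  opp_unique : ∀ h, ∃! h', G.opp h h'
  bdry_injective : Function.Injective G.bdry
  trivalent : ∀ h, (∀ i, h ≠ G.bdry i) → G.rot h ≠ h ∧ G.rot (G.rot (G.rot h)) = h
  univalent : ∀ i, G.rot (G.bdry i) = G.bdry i

variable {G : BoundaryGraph N}

/-- Otherwise the third iterate of the rotation would end at the fixed half-edge `G.bdry i` instead
of returning to `h`. -/
theorem IsMap.rot_ne_bdry (hG : G.IsMap) {h : G.HalfEdge} (hh : ∀ i, h ≠ G.bdry i) (i : Fin N) :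
    G.rot h ≠ G.bdry i := by
  intro e
  have := (hG.trivalent h hh).2
  rw [e, hG.univalent, hG.univalent] at this
  exact hh i this.symm

theorem IsMap.rotStep_right_unique (hG : G.IsMap) {d e e' : G.Dart} (h : G.RotStep d e)
    (h' : G.RotStep d e') : e = e' := by
  generalize hd : d = d' at h'
  rcases h with ⟨h1, k1⟩ | i | i | i | _ | _ <;> rcases h' with ⟨h2, k2⟩ | j | j | j | _ | _ <;>
    simp_all [Fin.ext_iff]
  · exact k2 _ hd.symm
  · exact congrArg Fin.val (hG.bdry_injective hd)
  · exact absurd hd i.isLt.ne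
  · exact congrArg G.bdry (Fin.ext hd)
  · exact absurd hd j.isLt.ne'

theorem IsMap.rotStep_left_unique (hG : G.IsMap) {d d' e : G.Dart} (h : G.RotStep d e)
    (h' : G.RotStep d' e) : d = d' := by
  generalize he : e = e' at h'
  rcases h with ⟨h1, k1⟩ | i | i | i | _ | _ <;> rcases h' with ⟨h2, k2⟩ | j | j | j | _ | _ <;>
    simp_all [Fin.ext_iff]
  · have e1 := (hG.trivalent h1 k1).2
    have e2 := (hG.trivalent h2 k2).2
    rw [he, e2] at e1
    exact e1.symm
  · exact hG.rot_ne_bdry k1 _ he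
  · exact congrArg G.bdry (Fin.ext he)
  · exact absurd he i.isLt.ne
  · exact hG.rot_ne_bdry k2 _ he.symm
  · exact congrArg Fin.val (hG.bdry_injective he)
  · exact absurd he j.isLt.ne'

theorem exists_rotStep (d : G.Dart) : ∃ e, G.RotStep d e := by
  rcases d with h | ⟨p, b⟩
  · by_cases hh : ∃ i, h = G.bdry i
    · obtain ⟨i, rfl⟩ := hh
      exact ⟨_, .up i⟩
    · push Not at hh
      exact ⟨_, .inner h hh⟩
  · cases b
    · induction p using Fin.cases with
      | zero => exact ⟨_, .inftyFirst⟩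
      | succ i => exact ⟨_, .right i⟩
    · induction p using Fin.lastCases with
      | last => exact ⟨_, .inftyLast⟩
      | cast i => exact ⟨_, .left i⟩

theorem IsMap.exists_rotStep_to (hG : G.IsMap) (e : G.Dart) : ∃ d, G.RotStep d e := by
  rcases e with h | ⟨p, b⟩
  · by_cases hh : ∃ i, h = G.bdry i
    · obtain ⟨i, rfl⟩ := hh
      exact ⟨_, .right i⟩
    · push Not at hh
      refine ⟨Sum.inl (G.rot (G.rot h)), ?_⟩
      have := RotStep.inner (G := G) (G.rot (G.rot h)) (hG.rot_ne_bdry (hG.rot_ne_bdry hh))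
      rwa [(hG.trivalent h hh).2] at this
  · cases b
    · induction p using Fin.cases with
      | zero => exact ⟨_, .inftyLast⟩
      | succ i => exact ⟨_, .left i⟩
    · induction p using Fin.lastCases with
      | last => exact ⟨_, .inftyFirst⟩
      | cast i => exact ⟨_, .up i⟩

theorem IsMap.link_unique (hG : G.IsMap) {d e e' : G.Dart} (h : G.Link d e) (h' : G.Link d e') :
    e = e' := by
  generalize hd : d = d' at h'
  rcases h with ⟨h1, h2, h3⟩ | ⟨p, b⟩ <;> rcases h' with ⟨k1, k2, k3⟩ | ⟨q, b'⟩
  · obtain rfl : h1 = k1 := Sum.inl_injective hd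
    rw [(hG.opp_unique h1).unique h3 k3]
  · cases hd
  · cases hd
  · cases hd
    rfl

theorem IsMap.exists_link (hG : G.IsMap) (d : G.Dart) : ∃ e, G.Link d e := by
  rcases d with h | ⟨p, b⟩
  · obtain ⟨h', hh, -⟩ := hG.opp_unique h
    exact ⟨_, .edge h h' hh⟩
  · exact ⟨_, .segment p b⟩

theorem IsMap.link_symm (hG : G.IsMap) {d e : G.Dart} (h : G.Link d e) : G.Link e d := by
  rcases h with ⟨h1, h2, h3⟩ | ⟨p, b⟩
  · exact .edge _ _ (hG.opp_symm _ _ h3)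
  · simpa using Link.segment (G := G) p !b

theorem IsMap.link_ne (hG : G.IsMap) {d e : G.Dart} (h : G.Link d e) : d ≠ e := by
  rcases h with ⟨h1, h2, h3⟩ | ⟨p, b⟩
  · exact fun e => hG.opp_ne _ _ h3 (Sum.inl_injective e)
  · simp

/-- The counterclockwise rotation of the darts. -/
noncomputable def IsMap.rotPerm (hG : G.IsMap) : Equiv.Perm G.Dart :=
  Equiv.ofBijective (fun d => (exists_rotStep d).choose)
    ⟨fun d d' e => hG.rotStep_left_unique (exists_rotStep d).choose_spec
        (by simp only at e; rw [e]; exact (exists_rotStep d').choose_spec),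
      fun e => ⟨_, hG.rotStep_right_unique (exists_rotStep _).choose_spec
        (hG.exists_rotStep_to e).choose_spec⟩⟩

theorem IsMap.rotStep_iff (hG : G.IsMap) (d e : G.Dart) : G.RotStep d e ↔ hG.rotPerm d = e :=
  ⟨fun h => hG.rotStep_right_unique (exists_rotStep d).choose_spec h,
    fun h => h ▸ (exists_rotStep d).choose_spec⟩

/-- The involution that exchanges the two halves of each edge. -/
noncomputable def IsMap.linkPerm (hG : G.IsMap) : Equiv.Perm G.Dart :=
  Function.Involutive.toPerm (fun d => (hG.exists_link d).choose) fun d =>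
    hG.link_unique (hG.exists_link _).choose_spec (hG.link_symm (hG.exists_link d).choose_spec)

theorem IsMap.link_iff (hG : G.IsMap) (d e : G.Dart) : G.Link d e ↔ hG.linkPerm d = e :=
  ⟨fun h => hG.link_unique (hG.exists_link d).choose_spec h,
    fun h => h ▸ (hG.exists_link d).choose_spec⟩

theorem IsMap.linkPerm_linkPerm (hG : G.IsMap) (d : G.Dart) : hG.linkPerm (hG.linkPerm d) = d :=
  (hG.link_iff _ _).1 (hG.link_symm ((hG.link_iff _ _).2 rfl))

/-- The permutation of the darts that walks around the faces. -/
noncomputable def IsMap.facePerm (hG : G.IsMap) : Equiv.Perm G.Dart :=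
  hG.linkPerm.trans hG.rotPerm.symm

theorem IsMap.faceStep_iff (hG : G.IsMap) (d d' : G.Dart) :
    G.FaceStep d d' ↔ hG.facePerm d = d' := by
  simp only [FaceStep, hG.link_iff, hG.rotStep_iff, facePerm, Equiv.trans_apply,
    Equiv.symm_apply_eq]
  constructor
  · rintro ⟨e, rfl, h⟩
    exact h.symm
  · exact fun h => ⟨_, rfl, h.symm⟩

theorem IsMap.finite_dart (hG : G.IsMap) : Finite G.Dart := by
  have := hG.finite
  infer_instance

theorem IsMap.card_dart (hG : G.IsMap) : Nat.card G.Dart = 2 * Nat.card G.Edge := by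
  have := hG.finite_dart
  have e : G.Edge = Quot fun x y => hG.linkPerm x = y := by
    unfold Edge
    congr
    funext x y
    exact propext (hG.link_iff x y)
  rw [e]
  exact card_eq_two_mul_card_quot _ hG.linkPerm_linkPerm
    fun d => (hG.link_ne ((hG.link_iff _ _).2 rfl)).symm

/-- The Euler characteristic of a connected map is at most `2`. -/
theorem IsMap.card_vertex_add_card_face_le (hG : G.IsMap)
    (hc : ∀ d e : G.Dart, Relation.EqvGen (fun x y => G.RotStep x y ∨ G.Link x y) d e) :
    Nat.card G.Vertex + Nat.card G.Face ≤ Nat.card G.Edge + 2 := by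
  have := hG.finite_dart
  have e1 : G.Edge = Quot fun x y => hG.linkPerm x = y := by
    unfold Edge
    congr
    funext x y
    exact propext (hG.link_iff x y)
  have e2 : G.Vertex = Quot fun x y => hG.rotPerm x = y := by
    unfold Vertex
    congr
    funext x y
    exact propext (hG.rotStep_iff x y)
  have e3 : G.Face = Quot fun x y => hG.rotPerm y = hG.linkPerm x := by
    unfold Face
    congr
    funext x y
    rw [hG.faceStep_iff, facePerm, Equiv.trans_apply, Equiv.symm_apply_eq]
    exact propext eq_comm
  have h := card_vertices_edges_faces_le hG.rotPerm hG.linkPerm hG.linkPerm_linkPerm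
    (by simpa only [hG.rotStep_iff, hG.link_iff] using hc)
  -- Substituting `|D| = 2E` turns `V + E + F ≤ |D| + 2` into `V + F ≤ E + 2`.
  rw [← e1, ← e2, ← e3, hG.card_dart] at h
  omega

end BoundaryGraph

/-! ### Tableaux and their arcs -/

namespace StandardTableau

variable {μ : YoungDiagram}

/-- The column that contains the number `i`. -/
def col (T : StandardTableau μ) (i : Fin μ.card) : ℕ := (T.entry.symm i).1.2

theorem row_col_mem (T : StandardTableau μ) (i : Fin μ.card) : (T.row i, T.col i) ∈ μ :=
  (T.entry.symm i).2

theorem exists_row_col (T : StandardTableau μ) {r c : ℕ} (h : (r, c) ∈ μ) :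
    ∃ i, T.row i = r ∧ T.col i = c :=
  ⟨T.entry ⟨(r, c), h⟩, by simp [row], by simp [col]⟩

theorem eq_of_row_col (T : StandardTableau μ) {i j : Fin μ.card} (hr : T.row i = T.row j)
    (hc : T.col i = T.col j) : i = j :=
  T.entry.symm.injective (Subtype.ext (Prod.ext hr hc))

theorem lt_of_col_lt (T : StandardTableau μ) {i j : Fin μ.card} (hr : T.row i = T.row j)
    (hc : T.col i < T.col j) : i < j := by
  simpa using T.row_lt (T.entry.symm i) (T.entry.symm j) hr hc

theorem lt_iff_col_lt (T : StandardTableau μ) {i j : Fin μ.card} (hr : T.row i = T.row j) :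
    i < j ↔ T.col i < T.col j := by
  refine ⟨fun h => ?_, T.lt_of_col_lt hr⟩
  by_contra hc
  rcases (not_lt.1 hc).lt_or_eq with h' | h'
  · exact absurd (T.lt_of_col_lt hr.symm h') h.asymm
  · exact h.ne (T.eq_of_row_col hr h'.symm)

/-- The boxes to the left of `i` in its row are all filled and hold exactly the smaller entries of
that row. Hence columns are a function of the row assignment. -/
theorem col_eq_card (T : StandardTableau μ) (i : Fin μ.card) :
    T.col i = Nat.card {j : Fin μ.card // T.row j = T.row i ∧ j < i} := by
  rw [← Nat.card_fin (T.col i)]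
  refine (Nat.card_congr (Equiv.ofBijective
    (fun j : {j : Fin μ.card // T.row j = T.row i ∧ j < i} =>
      (⟨T.col j.1, (T.lt_iff_col_lt j.2.1).1 j.2.2⟩ : Fin (T.col i))) ⟨?_, ?_⟩)).symm
  · intro j j' h
    exact Subtype.ext (T.eq_of_row_col (j.2.1.trans j'.2.1.symm) (congrArg Fin.val h))
  · intro c
    obtain ⟨j, hr, hc⟩ := T.exists_row_col
      (μ.up_left_mem le_rfl c.2.le (T.row_col_mem i))
    exact ⟨⟨j, hr, (T.lt_iff_col_lt hr).2 (hc ▸ c.2)⟩, Fin.ext hc⟩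

/-- A standard tableau is determined by the rows of the numbers. -/
theorem eq_of_row_eq {T T' : StandardTableau μ} (h : ∀ i, T.row i = T'.row i) : T = T' := by
  have hs : T.entry.symm = T'.entry.symm := by
    ext i : 2
    refine Prod.ext (h i) ?_
    change T.col i = T'.col i
    rw [col_eq_card, col_eq_card]
    simp only [h]
  have he : T.entry = T'.entry := by
    rw [← T.entry.symm_symm, hs, Equiv.symm_symm]
  cases T
  cases T'
  cases he
  rfl

theorem card_row (T : StandardTableau μ) (r : ℕ) :
    Nat.card {i : Fin μ.card // T.row i = r} = μ.rowLen r := by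
  rw [← Nat.card_fin (μ.rowLen r)]
  refine Nat.card_congr (Equiv.ofBijective
    (fun i : {i : Fin μ.card // T.row i = r} =>
      (⟨T.col i.1, YoungDiagram.mem_iff_lt_rowLen.1 (by
        have := T.row_col_mem i.1
        rwa [i.2] at this)⟩ :
        Fin (μ.rowLen r))) ⟨?_, ?_⟩)
  · intro i j h
    exact Subtype.ext (T.eq_of_row_col (i.2.trans j.2.symm) (congrArg Fin.val h))
  · intro c
    obtain ⟨i, hr, hc⟩ := T.exists_row_col (YoungDiagram.mem_iff_lt_rowLen.2 c.2)
    exact ⟨⟨i, hr⟩, Fin.ext hc⟩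

theorem exists_below (T : StandardTableau μ) {i : Fin μ.card} {r : ℕ} (h : T.row i = r + 1) :
    ∃ j, T.row j = r ∧ T.col j = T.col i ∧ j < i := by
  obtain ⟨j, hr, hc⟩ := T.exists_row_col
    (μ.up_left_mem (Nat.le_succ r) le_rfl (h ▸ T.row_col_mem i))
  refine ⟨j, hr, hc, ?_⟩
  simpa using T.col_lt (T.entry.symm j) (T.entry.symm i) hc
    (show T.row j < T.row i by omega)

theorem partner_spec (T : StandardTableau μ) {i j : Fin μ.card}
    (h : T.partner i = (j : WithBot (Fin μ.card))) :
    T.row j + 1 = T.row i ∧ j < i ∧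
      ∀ i' < i, T.row i' = T.row i → T.partner i' ≠ (j : WithBot (Fin μ.card)) := by
  classical
  rw [partner] at h
  have := Finset.mem_of_max h
  simpa using this

theorem le_of_partner (T : StandardTableau μ) {i j j' : Fin μ.card}
    (h : T.partner i = (j : WithBot (Fin μ.card))) (hr : T.row j' + 1 = T.row i) (hlt : j' < i)
    (hu : ∀ i' < i, T.row i' = T.row i → T.partner i' ≠ (j' : WithBot (Fin μ.card))) :
    j' ≤ j := by
  classical
  rw [partner] at h
  exact Finset.le_max_of_eq (by simpa using ⟨hr, hlt, hu⟩) h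

/-- A ballot count. If `i` found no partner, every number of row `r` before `i` would be taken by a
number of row `r + 1` before `i`. But the columns show that row `r` has more numbers before `i` than
row `r + 1` has. -/
theorem exists_partner (T : StandardTableau μ) {i : Fin μ.card} {r : ℕ} (h : T.row i = r + 1) :
    ∃ j : Fin μ.card, T.partner i = (j : WithBot (Fin μ.card)) := by
  classical
  by_contra hne
  push Not at hne
  have hbot : T.partner i = ⊥ := by
    by_contra hb
    obtain ⟨j, hj⟩ := WithBot.ne_bot_iff_exists.1 hb
    exact hne j hj.symm
  rw [partner, Finset.max_eq_bot, Finset.filter_eq_empty_iff] at hbot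
  choose! g hg1 hg2 hg3 using fun (x : Fin μ.card) (hx : T.row x = r + 1) => T.exists_below hx
  let X := Finset.univ.filter fun x : Fin μ.card => T.row x = r + 1 ∧ x < i
  let Y := Finset.univ.filter fun x : Fin μ.card => T.row x = r ∧ x < i
  have h1 : Y.card ≤ X.card := by
    rw [← Finset.card_map ⟨_, WithBot.coe_injective⟩]
    refine (Finset.card_le_card ?_).trans (Finset.card_image_le (s := X) (f := T.partner))
    intro y hy
    obtain ⟨j, hj, rfl⟩ := Finset.mem_map.1 hy
    have hj := (Finset.mem_filter.1 hj).2
    have := @hbot j (Finset.mem_univ _)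
    simp only [not_and, not_forall, not_not] at this
    obtain ⟨i', h1, h2⟩ := this (by omega) hj.2
    exact Finset.mem_image.2 ⟨i'.1, Finset.mem_filter.2 ⟨Finset.mem_univ _, by omega, i'.2⟩, h2⟩
  -- The box below a number at most `i` of row `r + 1` holds a number smaller than `i`. Including
  -- `i` itself gives the strict inequality.
  have h2 : (insert i X).card ≤ Y.card := by
    refine Finset.card_le_card_of_injOn g ?_ ?_
    · intro x hx
      have hx : T.row x = r + 1 ∧ x ≤ i := by
        rcases Finset.mem_insert.1 (Finset.mem_coe.1 hx) with rfl | hx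
        · exact ⟨h, le_rfl⟩
        · have := (Finset.mem_filter.1 hx).2
          exact ⟨this.1, this.2.le⟩
      exact Finset.mem_coe.2 (Finset.mem_filter.2
        ⟨Finset.mem_univ _, hg1 x hx.1, (hg3 x hx.1).trans_le hx.2⟩)
    · have hr : ∀ x ∈ (↑(insert i X) : Set (Fin μ.card)), T.row x = r + 1 := by
        intro x hx
        rcases Finset.mem_insert.1 (Finset.mem_coe.1 hx) with rfl | hx
        · exact h
        · exact (Finset.mem_filter.1 hx).2.1
      intro x hx y hy hxy
      refine T.eq_of_row_col ((hr x hx).trans (hr y hy).symm) ?_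
      rw [← hg2 x (hr x hx), ← hg2 y (hr y hy), hxy]
  rw [Finset.card_insert_of_notMem (by simp [X])] at h2
  omega

/-! ### Arcs between consecutive rows form a noncrossing matching -/

section Arcs

variable {T : StandardTableau μ} {r : ℕ}

theorem Arc.row_right (a : T.Arc r) : T.row a.right = r + 1 := a.2.1

theorem Arc.row_left (a : T.Arc r) : T.row a.left = r := by
  have h1 := (T.partner_spec a.2.2).1
  have h2 := a.2.1
  simp only [Arc.left]
  omega

theorem Arc.left_lt_right (a : T.Arc r) : a.left < a.right := (T.partner_spec a.2.2).2.1

theorem Arc.right_injective : Function.Injective (Arc.right : T.Arc r → Fin μ.card) := by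
  rintro ⟨⟨l, i⟩, hi, h⟩ ⟨⟨l', i'⟩, hi', h'⟩ (rfl : i = i')
  have := WithBot.coe_injective (h.symm.trans h')
  simp only at this
  subst this
  rfl

theorem Arc.left_injective : Function.Injective (Arc.left : T.Arc r → Fin μ.card) := by
  have key : ∀ a b : T.Arc r, a.left = b.left → ¬ a.right < b.right := by
    intro a b h hlt
    refine (T.partner_spec b.2.2).2.2 a.right hlt (a.row_right.trans b.row_right.symm) ?_
    have := a.2.2
    simp only [Arc.left] at h
    rwa [h] at this
  intro a b h
  exact Arc.right_injective (le_antisymm (not_lt.1 (key b a h.symm)) (not_lt.1 (key a b h)))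

/-- If `b` ended later, `b.left` would still be free when `a.right` is treated, and it would be a
larger choice than `a.left`. -/
theorem Arc.right_lt_right (a b : T.Arc r) (h1 : a.left < b.left) (h2 : b.left < a.right) :
    b.right < a.right := by
  by_contra hlt
  have hne : a.right ≠ b.right := fun e => h1.ne (congrArg Arc.left (Arc.right_injective e))
  have hlt : a.right < b.right := lt_of_le_of_ne (not_lt.1 hlt) hne
  have hr := b.row_left
  refine absurd (T.le_of_partner a.2.2 (j' := b.left) ?_ h2 ?_) (not_le.2 h1)
  · rw [hr]
    exact a.row_right.symm
  · intro i' hi' hrow hp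
    let c : T.Arc r := ⟨(b.left, i'), hrow.trans a.row_right, hp⟩
    have : c = b := Arc.left_injective rfl
    have h3 : i' = b.right := congrArg Arc.right this
    exact absurd (h3 ▸ hi' : b.right < a.right) hlt.asymm

theorem exists_arc_right {i : Fin μ.card} (h : T.row i = r + 1) : ∃ a : T.Arc r, a.right = i := by
  obtain ⟨j, hj⟩ := T.exists_partner h
  exact ⟨⟨(j, i), h, hj⟩, rfl⟩

theorem card_arc (T : StandardTableau μ) (r : ℕ) : Nat.card (T.Arc r) = μ.rowLen (r + 1) := by
  rw [← T.card_row]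
  refine Nat.card_congr (Equiv.ofBijective (fun a => ⟨a.right, a.row_right⟩) ⟨?_, ?_⟩)
  · exact fun a b h => Arc.right_injective (congrArg Subtype.val h)
  · rintro ⟨i, hi⟩
    obtain ⟨a, rfl⟩ := exists_arc_right hi
    exact ⟨a, rfl⟩

/-- Arcs biject with the upper row by their right ends and inject into the lower row by their left
ends. For rows of equal length the injection is onto. This puts every bottom-row number on a first
arc. -/
theorem exists_arc_left {i : Fin μ.card} (hμ : μ.rowLen (r + 1) = μ.rowLen r) (h : T.row i = r) :
    ∃ a : T.Arc r, a.left = i := by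
  have hinj : Function.Injective
      (fun a : T.Arc r => (⟨a.left, a.row_left⟩ : {i : Fin μ.card // T.row i = r})) :=
    fun a b h => Arc.left_injective (congrArg Subtype.val h)
  obtain ⟨a, ha⟩ := (hinj.bijective_of_nat_card_le
    (by rw [T.card_row, T.card_arc, hμ])).surjective ⟨i, h⟩
  exact ⟨a, congrArg Subtype.val ha⟩

end Arcs

end StandardTableau

/-- The Young diagrams with at most three rows whose two longest rows have the same length. -/
structure IsThreeRow (μ : YoungDiagram) : Prop where
  row_lt : ∀ c ∈ μ, c.1 < 3
  rowLen_one : μ.rowLen 1 = μ.rowLen 0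

namespace StandardTableau

variable {μ : YoungDiagram}

theorem row_lt_three (hμ : IsThreeRow μ) (T : StandardTableau μ) (i : Fin μ.card) : T.row i < 3 :=
  hμ.row_lt _ (T.row_col_mem i)

theorem card_eq_rowLen (hμ : IsThreeRow μ) (T : StandardTableau μ) :
    μ.card = μ.rowLen 0 + μ.rowLen 1 + μ.rowLen 2 := by
  classical
  rw [← T.card_row 0, ← T.card_row 1, ← T.card_row 2]
  have h := Finset.card_eq_sum_card_fiberwise (f := T.row) (s := Finset.univ)
    (t := Finset.range 3) fun i _ => Finset.mem_coe.2 (Finset.mem_range.2 (T.row_lt_three hμ i))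
  simp only [Finset.card_univ, Fintype.card_fin, Finset.sum_range_succ, Finset.sum_range_zero,
    zero_add] at h
  simp only [Nat.card_eq_fintype_card, Fintype.card_subtype]
  exact h

end StandardTableau

/-! ### The shape `(n, k, k)` -/

theorem mem_shapeNKK {n k : ℕ} (hnk : n ≤ k) {r c : ℕ} :
    (r, c) ∈ shapeNKK n k hnk ↔ r = 0 ∧ c < k ∨ r = 1 ∧ c < k ∨ r = 2 ∧ c < n := by
  rw [shapeNKK, YoungDiagram.mem_ofRowLens]
  rcases r with _ | _ | _ | r <;> simp

theorem rowLen_eq_of_mem_iff {μ : YoungDiagram} {r m : ℕ} (h : ∀ c, (r, c) ∈ μ ↔ c < m) :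
    μ.rowLen r = m :=
  eq_of_forall_lt_iff fun c => by rw [← YoungDiagram.mem_iff_lt_rowLen, h]

theorem rowLen_shapeNKK {n k : ℕ} (hnk : n ≤ k) : (shapeNKK n k hnk).rowLen 0 = k ∧
    (shapeNKK n k hnk).rowLen 1 = k ∧ (shapeNKK n k hnk).rowLen 2 = n := by
  refine ⟨rowLen_eq_of_mem_iff ?_, rowLen_eq_of_mem_iff ?_, rowLen_eq_of_mem_iff ?_⟩ <;>
  · intro c
    rw [mem_shapeNKK]
    simp

theorem isThreeRow_shapeNKK {n k : ℕ} (hnk : n ≤ k) : IsThreeRow (shapeNKK n k hnk) where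
  row_lt := by
    rintro ⟨r, c⟩ h
    rw [mem_shapeNKK] at h
    simp only
    omega
  rowLen_one := by
    obtain ⟨h0, h1, -⟩ := rowLen_shapeNKK hnk
    rw [h0, h1]

/-! ### Arcs above a gap and labels of the faces -/

section Intervals

variable {ι : Type*} {l r : ι → ℕ} {lp rp t t' : ℕ}

/-- Between two consecutive crossings on an arc, the shadow on the boundary line stays below the
same arcs of a noncrossing family. -/
theorem cover_iff_of_consecutive (hlr : ∀ i, l i < r i)
    (hnc : ∀ i j, l i = l j ∧ r i = r j ∨ r i < l j ∨ r j < l i ∨ l i < l j ∧ r j < r i ∨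
      l j < l i ∧ r i < r j)
    (hl : ∀ i, l i ≠ lp) (hr : ∀ i, r i ≠ rp)
    (ht : t = lp ∨ ∃ i, (l i < lp ∧ lp < r i ∧ r i < rp ∨ lp < l i ∧ l i < rp ∧ rp < r i) ∧
      t = if lp < l i then l i else r i)
    (ht' : t' = rp ∨ ∃ i, (l i < lp ∧ lp < r i ∧ r i < rp ∨ lp < l i ∧ l i < rp ∧ rp < r i) ∧
      t' = if lp < l i then l i else r i)
    (hlt : t < t')
    (hcons : ∀ i, (l i < lp ∧ lp < r i ∧ r i < rp ∨ lp < l i ∧ l i < rp ∧ rp < r i) →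
      ¬ (t < (if lp < l i then l i else r i) ∧ (if lp < l i then l i else r i) < t')) (i : ι) :
    (l i < t + 1 ∧ t + 1 ≤ r i) ↔ (l i < t' ∧ t' ≤ r i) := by
  have h1 := hlr i
  have h2 := hl i
  have h3 := hr i
  have h4 := hcons i
  -- An arc over just one of the two gaps has exactly one endpoint strictly between `t` and `t'`. By
  -- `hcons` it does not cross the base arc, so it is nested inside it. It would then cross or share
  -- an endpoint with the arc that defines `t` or `t'`, which leaves the base interval.
  rcases ht with rfl | ⟨j, hj, rfl⟩ <;> rcases ht' with rfl | ⟨k, hk, rfl⟩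
  · split_ifs at h4 <;> omega
  · have := hnc i k
    split_ifs at * <;> omega
  · have := hnc i j
    split_ifs at * <;> omega
  · have := hnc i k
    have := hnc i j
    split_ifs at * <;> omega

/-- An arc has a point above which there are exactly the arcs that contain it. -/
theorem cover_iff_of_minimal (hlr : ∀ i, l i < r i)
    (hnc : ∀ i j, l i = l j ∧ r i = r j ∨ r i < l j ∨ r j < l i ∨ l i < l j ∧ r j < r i ∨
      l j < l i ∧ r i < r j)
    (hl : ∀ i, l i ≠ lp) (hr : ∀ i, r i ≠ rp) (hlrp : lp < rp)
    (ht : t = rp ∨ ∃ i, lp < l i ∧ l i < rp ∧ rp < r i ∧ t = l i)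
    (hmin : ∀ i, lp < l i → l i < rp → rp < r i → t ≤ l i) (hmin' : t ≤ rp) (i : ι) :
    (l i < t ∧ t ≤ r i) ↔ (l i < lp ∧ rp < r i) := by
  have h1 := hlr i
  have h2 := hl i
  have h3 := hr i
  have h4 := hmin i
  -- If `t` is the left end of an arc `j` leaving to the right, any arc over this gap that does not
  -- enclose the base arc would cross `j` or contradict the minimality of `t`.
  rcases ht with rfl | ⟨j, hj⟩
  · omega
  · have := hnc i j
    omega

end Intervals

namespace StandardTableau

variable {μ : YoungDiagram} {T : StandardTableau μ} {r : ℕ}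

theorem Arc.left_lt_right_val (a : T.Arc r) : (a.left : ℕ) < a.right := a.left_lt_right

theorem Arc.left_ne_right (a b : T.Arc r) : (a.left : ℕ) ≠ b.right := by
  intro h
  have h1 := a.row_left
  have h2 := b.row_right
  rw [Fin.ext h] at h1
  omega

theorem Arc.noncrossing (a b : T.Arc r) :
    (a.left : ℕ) = b.left ∧ (a.right : ℕ) = b.right ∨ (a.right : ℕ) < b.left ∨
      (b.right : ℕ) < a.left ∨ (a.left : ℕ) < b.left ∧ (b.right : ℕ) < a.right ∨
      (b.left : ℕ) < a.left ∧ (a.right : ℕ) < b.right := by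
  have h1 := Arc.left_ne_right a b
  have h2 := Arc.left_ne_right b a
  have h3 : (a.left : ℕ) < b.left → (b.left : ℕ) < a.right → (b.right : ℕ) < a.right :=
    Arc.right_lt_right a b
  have h4 : (b.left : ℕ) < a.left → (a.left : ℕ) < b.right → (a.right : ℕ) < b.right :=
    Arc.right_lt_right b a
  have h5 : (a.left : ℕ) = b.left → (a.right : ℕ) = b.right := fun h => by
    rw [Arc.left_injective (Fin.ext h)]
  omega

theorem Arc.left_ne_left (a : T.Arc 0) (b : T.Arc 1) : (a.left : ℕ) ≠ b.left := by
  intro h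
  have h1 := a.row_left
  have h2 := b.row_left
  rw [Fin.ext h] at h1
  omega

theorem Arc.right_ne_right (a : T.Arc 0) (b : T.Arc 1) : (a.right : ℕ) ≠ b.right := by
  intro h
  have h1 := a.row_right
  have h2 := b.row_right
  rw [Fin.ext h] at h1
  omega

theorem Arc.fst_left_ne_snd_right (a : T.Arc 0) (b : T.Arc 1) : (a.left : ℕ) ≠ b.right := by
  intro h
  have h1 := a.row_left
  have h2 := b.row_right
  rw [Fin.ext h] at h1
  omega

/-- The arcs between row `r` and row `r + 1` that pass over the `x`-th gap of the boundary line. -/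
def cover (T : StandardTableau μ) (r x : ℕ) : Set (T.Arc r) :=
  {a | (a.left : ℕ) < x ∧ x ≤ a.right}

theorem mem_cover {x : ℕ} {a : T.Arc r} : a ∈ T.cover r x ↔ (a.left : ℕ) < x ∧ x ≤ a.right :=
  Iff.rfl

theorem cover_zero : T.cover r 0 = ∅ := by
  ext a
  simp [cover]

theorem cover_card : T.cover r μ.card = ∅ := by
  ext a
  simp [cover]

/-- Gap `x` lies immediately before the point with index `x`, so going from gap `i` to gap `i + 1`
passes point `i`. At a left end only `a` opens. -/
theorem cover_left_succ (a : T.Arc r) : T.cover r (a.left + 1) = insert a (T.cover r a.left) := by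
  ext b
  rw [Set.mem_insert_iff, mem_cover, mem_cover]
  have h1 := a.left_lt_right_val
  have h2 := b.left_lt_right_val
  have h3 := Arc.noncrossing a b
  have h4 := Arc.left_ne_right a b
  have h5 : b = a ↔ (a.left : ℕ) = b.left :=
    ⟨fun h => by rw [h], fun h => (Arc.left_injective (Fin.ext h)).symm⟩
  rw [h5]
  omega

theorem notMem_cover_left (a : T.Arc r) : a ∉ T.cover r a.left := fun h => h.1.ne rfl

/-- Noncrossing arcs behave like parentheses: whatever opens under `a` has closed again before `a`
does. -/
theorem cover_right (a : T.Arc r) : T.cover r a.right = T.cover r (a.left + 1) := by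
  ext b
  rw [mem_cover, mem_cover]
  have h1 := a.left_lt_right_val
  have h2 := b.left_lt_right_val
  have h3 := Arc.noncrossing a b
  have h4 := Arc.left_ne_right a b
  have h5 := Arc.left_ne_right b a
  omega

theorem cover_right_succ (a : T.Arc r) : T.cover r (a.right + 1) = T.cover r a.left := by
  ext b
  rw [mem_cover, mem_cover]
  have h1 := a.left_lt_right_val
  have h2 := b.left_lt_right_val
  have h3 := Arc.noncrossing a b
  have h4 := Arc.left_ne_right a b
  have h5 := Arc.left_ne_right b a
  omega

theorem cover_succ {i : Fin μ.card} (h1 : ∀ a : T.Arc r, a.left ≠ i)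
    (h2 : ∀ a : T.Arc r, a.right ≠ i) : T.cover r (i + 1) = T.cover r i := by
  ext a
  rw [mem_cover, mem_cover]
  have h1 : (a.left : ℕ) ≠ i := fun h => h1 a (Fin.ext h)
  have h2 : (a.right : ℕ) ≠ i := fun h => h2 a (Fin.ext h)
  omega

theorem cover_fst_succ_of_snd_right (b : T.Arc 1) :
    T.cover 0 (b.right + 1) = T.cover 0 b.right :=
  cover_succ (fun a h => Arc.fst_left_ne_snd_right a b (congrArg _ h))
    fun a h => Arc.right_ne_right a b (congrArg _ h)

theorem cover_snd_succ_of_fst_left (a : T.Arc 0) :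
    T.cover 1 (a.left + 1) = T.cover 1 a.left :=
  cover_succ (fun b h => Arc.left_ne_left a b (congrArg _ h.symm))
    fun b h => Arc.fst_left_ne_snd_right a b (congrArg _ h.symm)

theorem cover_snd_succ_of_fst_right (a : T.Arc 0) (h : ∀ b : T.Arc 1, b.left ≠ a.right) :
    T.cover 1 (a.right + 1) = T.cover 1 a.right :=
  cover_succ h fun b h => Arc.right_ne_right a b (congrArg _ h.symm)

/-! #### Positions on the arcs -/

theorem Crossing.posFst_val (c : T.Crossing) : (c.posFst : ℕ) =
    if (c.fst.left : ℕ) < c.snd.left then (c.snd.left : ℕ) else c.snd.right := by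
  rw [posFst, apply_ite Fin.val]
  rfl

/-- The condition is turned around so that positions on both kinds of arc have the form used in
`cover_iff_of_consecutive`. -/
theorem Crossing.posSnd_val (c : T.Crossing) : (c.posSnd : ℕ) =
    if (c.snd.left : ℕ) < c.fst.left then (c.fst.left : ℕ) else c.fst.right := by
  rw [posSnd, apply_ite Fin.val]
  have := Arc.left_ne_left c.fst c.snd
  simp only [Fin.lt_def]
  split_ifs <;> first | rfl | omega

theorem Crossing.interlace (c : T.Crossing) :
    (c.snd.left : ℕ) < c.fst.left ∧ (c.fst.left : ℕ) < c.snd.right ∧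
      (c.snd.right : ℕ) < c.fst.right ∨
    (c.fst.left : ℕ) < c.snd.left ∧ (c.snd.left : ℕ) < c.fst.right ∧
      (c.fst.right : ℕ) < c.snd.right := c.2

theorem Crossing.ext {c c' : T.Crossing} (h1 : c.fst = c'.fst) (h2 : c.snd = c'.snd) : c = c' :=
  Subtype.ext (Prod.ext h1 h2)

/-- The second arc through a point of a first arc is determined by the position. -/
theorem Crossing.eq_of_posFst {c c' : T.Crossing} (h1 : c.fst = c'.fst)
    (h2 : c.posFst = c'.posFst) : c = c' := by
  refine Crossing.ext h1 ?_
  have h3 := congrArg Fin.val h2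
  rw [posFst_val, posFst_val] at h3
  split_ifs at h3
  · exact Arc.left_injective (Fin.ext h3)
  · exact absurd h3 (Arc.left_ne_right _ _)
  · exact absurd h3.symm (Arc.left_ne_right _ _)
  · exact Arc.right_injective (Fin.ext h3)

theorem Crossing.eq_of_posSnd {c c' : T.Crossing} (h1 : c.snd = c'.snd)
    (h2 : c.posSnd = c'.posSnd) : c = c' := by
  refine Crossing.ext ?_ h1
  have h3 := congrArg Fin.val h2
  rw [posSnd_val, posSnd_val] at h3
  split_ifs at h3
  · exact Arc.left_injective (Fin.ext h3)
  · exact absurd h3 (Arc.left_ne_right _ _)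
  · exact absurd h3.symm (Arc.left_ne_right _ _)
  · exact Arc.right_injective (Fin.ext h3)

theorem Crossing.left_lt_posFst (c : T.Crossing) : c.fst.left < c.posFst := by
  rw [Fin.lt_def, posFst_val]
  have := c.interlace
  split_ifs <;> omega

theorem Crossing.posFst_lt_right (c : T.Crossing) : c.posFst < c.fst.right := by
  rw [Fin.lt_def, posFst_val]
  have := c.interlace
  split_ifs <;> omega

theorem Crossing.left_lt_posSnd (c : T.Crossing) : c.snd.left < c.posSnd := by
  rw [Fin.lt_def, posSnd_val]
  have := c.interlace
  split_ifs <;> omega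

theorem Crossing.posSnd_lt_right (c : T.Crossing) : c.posSnd < c.snd.right := by
  rw [Fin.lt_def, posSnd_val]
  have := c.interlace
  split_ifs <;> omega

theorem FstOut.pos {a : T.Arc 0} {h : T.ResolvedHalfEdge} {t : Fin μ.card} (hh : T.FstOut a h t) :
    t = a.left ∨ ∃ c : T.Crossing, c.fst = a ∧ t = c.posFst := by
  rcases hh with _ | ⟨c, hc⟩
  · exact Or.inl rfl
  · exact Or.inr ⟨c, hc, rfl⟩

theorem FstIn.pos {a : T.Arc 0} {h : T.ResolvedHalfEdge} {t : Fin μ.card} (hh : T.FstIn a h t) :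
    t = a.right ∨ ∃ c : T.Crossing, c.fst = a ∧ t = c.posFst := by
  rcases hh with ⟨c, hc⟩ | ⟨b, hb⟩ | hb
  · exact Or.inr ⟨c, hc, rfl⟩
  · exact Or.inl rfl
  · exact Or.inl rfl

theorem SndOut.pos {b : T.Arc 1} {h : T.ResolvedHalfEdge} {t : Fin μ.card} (hh : T.SndOut b h t) :
    t = b.right ∨ ∃ c : T.Crossing, c.snd = b ∧ t = c.posSnd := by
  rcases hh with _ | ⟨c, hc⟩
  · exact Or.inl rfl
  · exact Or.inr ⟨c, hc, rfl⟩

theorem SndIn.pos {b : T.Arc 1} {h : T.ResolvedHalfEdge} {t : Fin μ.card} (hh : T.SndIn b h t) :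
    t = b.left ∨ ∃ c : T.Crossing, c.snd = b ∧ t = c.posSnd := by
  rcases hh with ⟨c, hc⟩ | _
  · exact Or.inr ⟨c, hc, rfl⟩
  · exact Or.inl rfl

/-- The set of second arcs overhead is constant along a piece of a first arc between consecutive
points. This makes both ends of the piece see the same faces. -/
theorem cover_snd_of_consecutive {a : T.Arc 0} {t t' : Fin μ.card}
    (ht : t = a.left ∨ ∃ c : T.Crossing, c.fst = a ∧ t = c.posFst)
    (ht' : t' = a.right ∨ ∃ c : T.Crossing, c.fst = a ∧ t' = c.posFst) (hlt : t < t')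
    (hcons : ∀ c : T.Crossing, c.fst = a → ¬ (t < c.posFst ∧ c.posFst < t')) :
    T.cover 1 (t + 1) = T.cover 1 t' := by
  ext b
  refine cover_iff_of_consecutive (l := fun b : T.Arc 1 => (b.left : ℕ)) (r := fun b => b.right)
    (lp := a.left) (rp := a.right) Arc.left_lt_right_val Arc.noncrossing
    (fun b => (Arc.left_ne_left a b).symm) (fun b => (Arc.right_ne_right a b).symm) ?_ ?_ hlt ?_ b
  · rcases ht with rfl | ⟨c, rfl, rfl⟩
    · exact Or.inl rfl
    · exact Or.inr ⟨c.snd, c.interlace, c.posFst_val⟩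
  · rcases ht' with rfl | ⟨c, rfl, rfl⟩
    · exact Or.inl rfl
    · exact Or.inr ⟨c.snd, c.interlace, c.posFst_val⟩
  · intro b hb
    have := hcons ⟨(a, b), hb⟩ rfl
    rwa [Fin.lt_def, Fin.lt_def, Crossing.posFst_val] at this

theorem cover_fst_of_consecutive {b : T.Arc 1} {t t' : Fin μ.card}
    (ht : t = b.left ∨ ∃ c : T.Crossing, c.snd = b ∧ t = c.posSnd)
    (ht' : t' = b.right ∨ ∃ c : T.Crossing, c.snd = b ∧ t' = c.posSnd) (hlt : t < t')
    (hcons : ∀ c : T.Crossing, c.snd = b → ¬ (t < c.posSnd ∧ c.posSnd < t')) :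
    T.cover 0 (t + 1) = T.cover 0 t' := by
  ext a
  refine cover_iff_of_consecutive (l := fun a : T.Arc 0 => (a.left : ℕ)) (r := fun a => a.right)
    (lp := b.left) (rp := b.right) Arc.left_lt_right_val Arc.noncrossing
    (fun a => Arc.left_ne_left a b) (fun a => Arc.right_ne_right a b) ?_ ?_ hlt ?_ a
  · rcases ht with rfl | ⟨c, rfl, rfl⟩
    · exact Or.inl rfl
    · exact Or.inr ⟨c.fst, c.interlace.symm, c.posSnd_val⟩
  · rcases ht' with rfl | ⟨c, rfl, rfl⟩
    · exact Or.inl rfl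
    · exact Or.inr ⟨c.fst, c.interlace.symm, c.posSnd_val⟩
  · intro a ha
    have := hcons ⟨(a, b), ha.symm⟩ rfl
    rwa [Fin.lt_def, Fin.lt_def, Crossing.posSnd_val] at this

/-! #### Labels -/

/-- The sets of first and second arcs above the face to the left of a half-edge. -/
def halfLabel (T : StandardTableau μ) : T.ResolvedHalfEdge → Set (T.Arc 0) × Set (T.Arc 1)
  | Sum.inl i => (T.cover 0 i, T.cover 1 i)
  | Sum.inr (InnerVertex.tri b, Slot.first) => (T.cover 0 b.left, T.cover 1 b.left)
  | Sum.inr (InnerVertex.tri b, Slot.second) => (T.cover 0 (b.left + 1), T.cover 1 b.left)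
  | Sum.inr (InnerVertex.tri b, Slot.third) => (T.cover 0 (b.left + 1), T.cover 1 (b.left + 1))
  | Sum.inr (InnerVertex.sink c, Slot.first) => (T.cover 0 (c.fst.left + 1), T.cover 1 c.posFst)
  | Sum.inr (InnerVertex.sink c, Slot.second) => (T.cover 0 (c.posSnd + 1), T.cover 1 c.snd.left)
  | Sum.inr (InnerVertex.sink c, Slot.third) => (T.cover 0 c.fst.left, T.cover 1 (c.snd.left + 1))
  | Sum.inr (InnerVertex.source c, Slot.first) => (T.cover 0 c.fst.left, T.cover 1 (c.posFst + 1))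
  | Sum.inr (InnerVertex.source c, Slot.second) => (T.cover 0 c.posSnd, T.cover 1 (c.snd.left + 1))
  | Sum.inr (InnerVertex.source c, Slot.third) =>
    (T.cover 0 (c.fst.left + 1), T.cover 1 c.snd.left)

/-- The sets of first and second arcs above the face to the right of a half-edge. -/
def halfRight (T : StandardTableau μ) : T.ResolvedHalfEdge → Set (T.Arc 0) × Set (T.Arc 1)
  | Sum.inl i => (T.cover 0 (i + 1), T.cover 1 (i + 1))
  | Sum.inr (InnerVertex.tri b, Slot.first) => (T.cover 0 (b.left + 1), T.cover 1 b.left)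
  | Sum.inr (InnerVertex.tri b, Slot.second) => (T.cover 0 (b.left + 1), T.cover 1 (b.left + 1))
  | Sum.inr (InnerVertex.tri b, Slot.third) => (T.cover 0 b.left, T.cover 1 b.left)
  | Sum.inr (InnerVertex.sink c, Slot.first) => (T.cover 0 c.fst.left, T.cover 1 c.posFst)
  | Sum.inr (InnerVertex.sink c, Slot.second) =>
    (T.cover 0 (c.posSnd + 1), T.cover 1 (c.snd.left + 1))
  | Sum.inr (InnerVertex.sink c, Slot.third) => (T.cover 0 (c.fst.left + 1), T.cover 1 c.snd.left)
  | Sum.inr (InnerVertex.source c, Slot.first) =>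
    (T.cover 0 (c.fst.left + 1), T.cover 1 (c.posFst + 1))
  | Sum.inr (InnerVertex.source c, Slot.second) => (T.cover 0 c.posSnd, T.cover 1 c.snd.left)
  | Sum.inr (InnerVertex.source c, Slot.third) =>
    (T.cover 0 c.fst.left, T.cover 1 (c.snd.left + 1))

/-- The label of the face to the left of a dart; the face below the line has no label. -/
def label (T : StandardTableau μ) :
    T.resolvedMDiagram.Dart → Option (Set (T.Arc 0) × Set (T.Arc 1))
  | Sum.inl h => some (T.halfLabel h)
  | Sum.inr (p, false) => some (T.cover 0 p, T.cover 1 p)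
  | Sum.inr (_, true) => none

/-- The label of the face to the right of a dart. -/
def labelRight (T : StandardTableau μ) :
    T.resolvedMDiagram.Dart → Option (Set (T.Arc 0) × Set (T.Arc 1))
  | Sum.inl h => some (T.halfRight h)
  | Sum.inr (p, true) => some (T.cover 0 p, T.cover 1 p)
  | Sum.inr (_, false) => none

section

variable {a : T.Arc 0} {b : T.Arc 1} {h : T.ResolvedHalfEdge} {t : Fin μ.card}

/-- Along a first arc the other first arcs overhead never change, and `a` itself is counted on its
inner side only. Only the second arcs depend on `t`: a departing piece reads them just after `t`, an
arriving one just before. -/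
theorem FstOut.labels (hh : T.FstOut a h t) :
    T.halfLabel h = (T.cover 0 a.left, T.cover 1 (t + 1)) ∧
      T.halfRight h = (T.cover 0 (a.left + 1), T.cover 1 (t + 1)) := by
  rcases hh with _ | ⟨c, rfl⟩
  · simp [halfLabel, halfRight, cover_snd_succ_of_fst_left]
  · exact ⟨rfl, rfl⟩

theorem FstIn.labels (hh : T.FstIn a h t) :
    T.halfLabel h = (T.cover 0 (a.left + 1), T.cover 1 t) ∧
      T.halfRight h = (T.cover 0 a.left, T.cover 1 t) := by
  rcases hh with ⟨c, rfl⟩ | ⟨b, hb⟩ | hb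
  · exact ⟨rfl, rfl⟩
  · simp [halfLabel, halfRight, hb, cover_right, cover_right_succ]
  · simp [halfLabel, halfRight, cover_right, cover_right_succ, cover_snd_succ_of_fst_right a hb]

theorem SndOut.labels (hh : T.SndOut b h t) :
    T.halfLabel h = (T.cover 0 t, T.cover 1 (b.left + 1)) ∧
      T.halfRight h = (T.cover 0 t, T.cover 1 b.left) := by
  rcases hh with _ | ⟨c, rfl⟩
  · simp [halfLabel, halfRight, cover_right, cover_right_succ, cover_fst_succ_of_snd_right]
  · exact ⟨rfl, rfl⟩

theorem SndIn.labels (hh : T.SndIn b h t) :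
    T.halfLabel h = (T.cover 0 (t + 1), T.cover 1 b.left) ∧
      T.halfRight h = (T.cover 0 (t + 1), T.cover 1 (b.left + 1)) := by
  rcases hh with ⟨c, rfl⟩ | _
  · exact ⟨rfl, rfl⟩
  · exact ⟨rfl, rfl⟩

end

theorem ResolvedEdge.labels {h h' : T.ResolvedHalfEdge} (hh : T.ResolvedEdge h h') :
    T.halfLabel h = T.halfRight h' ∧ T.halfLabel h' = T.halfRight h := by
  rcases hh with ⟨a, _, _, t, t', hout, hin, hlt, hcons⟩ | ⟨b, _, _, t, t', hout, hin, hlt, hcons⟩ |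
    b | c
  · have := cover_snd_of_consecutive hout.pos hin.pos hlt hcons
    rw [hout.labels.1, hout.labels.2, hin.labels.1, hin.labels.2, this]
    exact ⟨rfl, rfl⟩
  · have := cover_fst_of_consecutive hin.pos hout.pos hlt hcons
    rw [hout.labels.1, hout.labels.2, hin.labels.1, hin.labels.2, this]
    exact ⟨rfl, rfl⟩
  · exact ⟨rfl, rfl⟩
  · exact ⟨rfl, rfl⟩

theorem label_of_link {d e : T.resolvedMDiagram.Dart} (h : T.resolvedMDiagram.Link d e) :
    T.label d = T.labelRight e := by
  rcases h with ⟨h, h', hh⟩ | ⟨p, b⟩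
  · refine congrArg some ?_
    rcases hh with hh | hh
    · exact hh.labels.1
    · exact hh.labels.2
  · cases b <;> rfl

/-- Consecutive half-edges about an inner vertex bound a common corner. For each orientation of a
crossing, its positions become explicit feet of arcs, and `cover_right` and `cover_right_succ` move
right feet to left feet. -/
theorem halfLabel_eq_halfRight_rot (v : T.InnerVertex) (s : Slot) :
    T.halfLabel (Sum.inr (v, s)) = T.halfRight (T.resolvedRot (Sum.inr (v, s))) := by
  rcases v with b | c | c
  · cases s <;> rfl
  all_goals
    have hi := c.interlace
    by_cases hc : c.fst.left < c.snd.left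
    · have h1 : c.posFst = c.snd.left := if_pos hc
      have h2 : c.posSnd = c.fst.right := if_pos hc
      cases s <;> simp only [resolvedRot, crossingRot, if_pos hc, Slot.prev, halfLabel, halfRight,
        h1, h2, cover_right, cover_right_succ]
    · have h1 : c.posFst = c.snd.right := if_neg hc
      have h2 : c.posSnd = c.fst.left := if_neg hc
      cases s <;> simp only [resolvedRot, crossingRot, if_neg hc, Slot.next, halfLabel, halfRight,
        h1, h2, cover_right, cover_right_succ]

theorem label_of_rotStep {d e : T.resolvedMDiagram.Dart} (h : T.resolvedMDiagram.RotStep d e) :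
    T.label d = T.labelRight e := by
  rcases h with ⟨h, hh⟩ | i | i | i | _ | _
  · refine congrArg some ?_
    rcases h with i | ⟨v, s⟩
    · exact absurd rfl (hh i)
    · exact halfLabel_eq_halfRight_rot v s
  · rfl
  · rfl
  · rfl
  -- No arc passes over the first or the last gap, so the labels agree across infinity.
  · simp [label, labelRight, cover_zero, cover_card]
  · rfl

theorem label_of_faceStep {d d' : T.resolvedMDiagram.Dart} (h : T.resolvedMDiagram.FaceStep d d') :
    T.label d = T.label d' := by
  obtain ⟨e, h1, h2⟩ := h
  rw [label_of_link h1, label_of_rotStep h2]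

/-- The label of a face. -/
def faceLabel (T : StandardTableau μ) :
    T.resolvedMDiagram.Face → Option (Set (T.Arc 0) × Set (T.Arc 1)) :=
  Quot.lift T.label fun _ _ => label_of_faceStep

/-! #### The faces below arcs and crossings -/

/-- The labels of the face below the line, of the unbounded face, of the face below the highest
part of an arc, and of the face below a crossing. -/
def peakLabel (T : StandardTableau μ) : Bool ⊕ (T.Arc 0 ⊕ (T.Arc 1 ⊕ T.Crossing)) →
    Option (Set (T.Arc 0) × Set (T.Arc 1))
  | Sum.inl false => none
  | Sum.inl true => some (∅, ∅)
  | Sum.inr (Sum.inl a) => some (T.cover 0 (a.left + 1),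
      {b | (b.left : ℕ) < a.left ∧ (a.right : ℕ) < b.right})
  | Sum.inr (Sum.inr (Sum.inl b)) => some ({a | (a.left : ℕ) < b.left ∧ (b.right : ℕ) < a.right},
      T.cover 1 (b.left + 1))
  | Sum.inr (Sum.inr (Sum.inr c)) =>
    some (T.cover 0 (c.fst.left + 1), T.cover 1 (c.snd.left + 1))

theorem self_mem_cover (a : T.Arc r) : a ∈ T.cover r (a.left + 1) :=
  ⟨Nat.lt_succ_self _, a.left_lt_right⟩

theorem cover_left_succ_injective {a b : T.Arc r}
    (h : T.cover r (a.left + 1) = T.cover r (b.left + 1)) : a = b := by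
  have h1 := (h ▸ self_mem_cover a : a ∈ T.cover r (b.left + 1)).1
  have h2 := (h ▸ self_mem_cover b : b ∈ T.cover r (a.left + 1)).1
  exact Arc.left_injective (Fin.ext (by omega))

/-- A set `T.cover r (a.left + 1)` determines `a`, its innermost arc. Confusing the peak of an arc
with a crossing would make two interlacing arcs nested. Confusing the peaks of a first and a second
arc would make each enclose the other. -/
theorem peakLabel_injective : Function.Injective T.peakLabel := by
  have hne : ∀ {r : ℕ} (a : T.Arc r), T.cover r (a.left + 1) ≠ ∅ :=
    fun a => Set.Nonempty.ne_empty ⟨a, self_mem_cover a⟩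
  have hac : ∀ (a : T.Arc 0) (c : T.Crossing), ¬ (T.cover 0 (a.left + 1) =
      T.cover 0 (c.fst.left + 1) ∧ {b : T.Arc 1 | (b.left : ℕ) < a.left ∧ (a.right : ℕ) < b.right} =
      T.cover 1 (c.snd.left + 1)) := by
    rintro a c ⟨h1, h2⟩
    obtain rfl := cover_left_succ_injective h1
    have h3 := self_mem_cover c.snd
    rw [← h2] at h3
    have h4 := h3.1
    have h5 := h3.2
    have := c.interlace
    omega
  have hbc : ∀ (b : T.Arc 1) (c : T.Crossing),
      ¬ ({a : T.Arc 0 | (a.left : ℕ) < b.left ∧ (b.right : ℕ) < a.right} =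
      T.cover 0 (c.fst.left + 1) ∧ T.cover 1 (b.left + 1) = T.cover 1 (c.snd.left + 1)) := by
    rintro b c ⟨h1, h2⟩
    obtain rfl := cover_left_succ_injective h2
    have h3 := self_mem_cover c.fst
    rw [← h1] at h3
    have h4 := h3.1
    have h5 := h3.2
    have := c.interlace
    omega
  have hab : ∀ (a : T.Arc 0) (b : T.Arc 1), ¬ (T.cover 0 (a.left + 1) =
      {a : T.Arc 0 | (a.left : ℕ) < b.left ∧ (b.right : ℕ) < a.right} ∧
      {b : T.Arc 1 | (b.left : ℕ) < a.left ∧ (a.right : ℕ) < b.right} =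
      T.cover 1 (b.left + 1)) := by
    rintro a b ⟨h1, h2⟩
    have h3 := self_mem_cover a
    have h4 := self_mem_cover b
    rw [h1] at h3
    rw [← h2] at h4
    have h5 := h3.1
    have h6 := h4.1
    omega
  rintro ((_ | _) | a | b | c) ((_ | _) | a' | b' | c') h <;>
    simp only [peakLabel, Option.some.injEq, Prod.mk.injEq, reduceCtorEq] at h
  · rfl
  · rfl
  · exact absurd h.1.symm (hne a')
  · exact absurd h.2.symm (hne b')
  · exact absurd h.1.symm (hne c'.fst)
  · exact absurd h.1 (hne a)
  · rw [cover_left_succ_injective h.1]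
  · exact absurd h (hab a b')
  · exact absurd h (hac a c')
  · exact absurd h.2 (hne b)
  · exact absurd ⟨h.1.symm, h.2.symm⟩ (hab a' b)
  · rw [cover_left_succ_injective h.2]
  · exact absurd h (hbc b c')
  · exact absurd h.1 (hne c.fst)
  · exact absurd ⟨h.1.symm, h.2.symm⟩ (hac a' c)
  · exact absurd ⟨h.1.symm, h.2.symm⟩ (hbc b' c)
  · rw [Crossing.ext (cover_left_succ_injective h.1) (cover_left_succ_injective h.2)]

/-- The half-edges that have the inside of their arc on the left. -/
def IsTop (T : StandardTableau μ) (h : T.ResolvedHalfEdge) : Prop :=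
  (∃ a t, T.FstIn a h t) ∨ ∃ b t, T.SndOut b h t

/-- Along `a`, the crossings with arcs coming in from the left precede those with arcs going out to
the right. The highest piece of `a` ends at the first outgoing arc, or at the right end of `a` if
there is none, which explains the minimum taken. -/
theorem exists_top_fst (a : T.Arc 0) : ∃ h, T.IsTop h ∧
    some (T.halfLabel h) = T.peakLabel (Sum.inr (Sum.inl a)) := by
  classical
  have hex : ∃ t : ℕ, t = a.right ∨ ∃ b : T.Arc 1, (a.left : ℕ) < b.left ∧
      (b.left : ℕ) < a.right ∧ (a.right : ℕ) < b.right ∧ t = b.left := ⟨_, Or.inl rfl⟩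
  have key := cover_iff_of_minimal (l := fun b : T.Arc 1 => (b.left : ℕ)) (r := fun b => b.right)
    (lp := a.left) (rp := a.right) Arc.left_lt_right_val Arc.noncrossing
    (fun b => (Arc.left_ne_left a b).symm) (fun b => (Arc.right_ne_right a b).symm)
    a.left_lt_right_val (Nat.find_spec hex)
    (fun b h1 h2 h3 => Nat.find_min' hex (Or.inr ⟨b, h1, h2, h3, rfl⟩))
    (Nat.find_min' hex (Or.inl rfl))
  obtain ⟨h, t, ht, hh⟩ : ∃ (h : T.ResolvedHalfEdge) (t : Fin μ.card), (t : ℕ) = Nat.find hex ∧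
      T.FstIn a h t := by
    rcases Nat.find_spec hex with h | ⟨b, h1, h2, h3, h4⟩
    · by_cases hb : ∃ b : T.Arc 1, b.left = a.right
      · obtain ⟨b, hb⟩ := hb
        exact ⟨_, _, h.symm, .endTri b hb⟩
      · push Not at hb
        exact ⟨_, _, h.symm, .endBdry hb⟩
    · refine ⟨_, _, ?_, .cross ⟨(a, b), Or.inr ⟨h1, h2, h3⟩⟩ rfl⟩
      rw [h4, Crossing.posFst_val]
      exact if_pos h1
  refine ⟨h, Or.inl ⟨a, t, hh⟩, ?_⟩
  rw [hh.labels.1, peakLabel, ht]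
  exact congrArg some (Prod.ext rfl (Set.ext key))

theorem exists_top_snd (b : T.Arc 1) : ∃ h, T.IsTop h ∧
    some (T.halfLabel h) = T.peakLabel (Sum.inr (Sum.inr (Sum.inl b))) := by
  classical
  have hex : ∃ t : ℕ, t = b.right ∨ ∃ a : T.Arc 0, (b.left : ℕ) < a.left ∧
      (a.left : ℕ) < b.right ∧ (b.right : ℕ) < a.right ∧ t = a.left := ⟨_, Or.inl rfl⟩
  have key := cover_iff_of_minimal (l := fun a : T.Arc 0 => (a.left : ℕ)) (r := fun a => a.right)
    (lp := b.left) (rp := b.right) Arc.left_lt_right_val Arc.noncrossing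
    (fun a => Arc.left_ne_left a b) (fun a => Arc.right_ne_right a b)
    b.left_lt_right_val (Nat.find_spec hex)
    (fun a h1 h2 h3 => Nat.find_min' hex (Or.inr ⟨a, h1, h2, h3, rfl⟩))
    (Nat.find_min' hex (Or.inl rfl))
  obtain ⟨h, t, ht, hh⟩ : ∃ (h : T.ResolvedHalfEdge) (t : Fin μ.card), (t : ℕ) = Nat.find hex ∧
      T.SndOut b h t := by
    rcases Nat.find_spec hex with h | ⟨a, h1, h2, h3, h4⟩
    · exact ⟨_, _, h.symm, .start⟩
    · refine ⟨_, _, ?_, .cross ⟨(a, b), Or.inl ⟨h1, h2, h3⟩⟩ rfl⟩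
      rw [h4, Crossing.posSnd_val]
      exact if_pos h1
  refine ⟨h, Or.inr ⟨b, t, hh⟩, ?_⟩
  rw [hh.labels.1, peakLabel, ht]
  exact congrArg some (Prod.ext (Set.ext key) rfl)

/-- The face below a crossing is seen from an arc end at the lower of its two vertices. That vertex
is the source or the sink according to the orientation. -/
theorem exists_top_crossing (c : T.Crossing) : ∃ h, T.IsTop h ∧
    some (T.halfLabel h) = T.peakLabel (Sum.inr (Sum.inr (Sum.inr c))) := by
  by_cases hc : c.fst.left < c.snd.left
  · refine ⟨_, Or.inr ⟨_, _, .cross c rfl⟩, ?_⟩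
    have h2 : c.posSnd = c.fst.right := if_pos hc
    simp only [halfLabel, peakLabel, h2, cover_right]
  · refine ⟨_, Or.inl ⟨_, _, .cross c rfl⟩, ?_⟩
    have h2 : c.posFst = c.snd.right := if_neg hc
    simp only [halfLabel, peakLabel, h2, cover_right]

/-- The witness dart matters as well as its label: except for the two faces at the line, it lies on
the upper side of its face. Once every face is known to be a peak, this gives a way up from each
bounded face. -/
theorem exists_peak (x : Bool ⊕ (T.Arc 0 ⊕ (T.Arc 1 ⊕ T.Crossing))) :
    ∃ d : T.resolvedMDiagram.Dart, T.label d = T.peakLabel x ∧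
      (d = Sum.inr (0, true) ∨ d = Sum.inr (0, false) ∨
        ∃ h : T.ResolvedHalfEdge, T.IsTop h ∧ d = Sum.inl h) := by
  rcases x with (_ | _) | a | b | c
  · exact ⟨Sum.inr (0, true), rfl, Or.inl rfl⟩
  · exact ⟨Sum.inr (0, false), by simp [label, peakLabel, cover_zero], Or.inr (Or.inl rfl)⟩
  · obtain ⟨h, h1, h2⟩ := exists_top_fst a
    exact ⟨Sum.inl h, h2, Or.inr (Or.inr ⟨h, h1, rfl⟩)⟩
  · obtain ⟨h, h1, h2⟩ := exists_top_snd b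
    exact ⟨Sum.inl h, h2, Or.inr (Or.inr ⟨h, h1, rfl⟩)⟩
  · obtain ⟨h, h1, h2⟩ := exists_top_crossing c
    exact ⟨Sum.inl h, h2, Or.inr (Or.inr ⟨h, h1, rfl⟩)⟩

end StandardTableau

/-! ### Resolved diagrams are webs -/

namespace StandardTableau

variable {μ : YoungDiagram} {T : StandardTableau μ}

/-! #### The two half-edges of an edge determine each other -/

section

variable {a a' : T.Arc 0} {b b' : T.Arc 1} {h h' : T.ResolvedHalfEdge} {t t' : Fin μ.card}

theorem FstOut.unique (h1 : T.FstOut a h t) (h2 : T.FstOut a' h t') : a = a' ∧ t = t' := by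
  generalize e : h = k at h2
  rcases h1 with _ | ⟨c, rfl⟩ <;> rcases h2 with _ | ⟨c', rfl⟩
  · have e := Sum.inl_injective e
    exact ⟨Arc.left_injective e, e⟩
  · cases e
  · cases e
  · cases e
    exact ⟨rfl, rfl⟩

theorem FstIn.unique (h1 : T.FstIn a h t) (h2 : T.FstIn a' h t') : a = a' ∧ t = t' := by
  generalize e : h = k at h2
  rcases h1 with ⟨c, rfl⟩ | ⟨b, hb⟩ | hb <;> rcases h2 with ⟨c', rfl⟩ | ⟨b', hb'⟩ | hb'
  case cross.cross =>
    cases e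
    exact ⟨rfl, rfl⟩
  case endTri.endTri =>
    cases e
    have e := hb.symm.trans hb'
    exact ⟨Arc.right_injective e, e⟩
  case endBdry.endBdry =>
    have e := Sum.inl_injective e
    exact ⟨Arc.right_injective e, e⟩
  all_goals cases e

theorem SndOut.unique (h1 : T.SndOut b h t) (h2 : T.SndOut b' h t') : b = b' ∧ t = t' := by
  generalize e : h = k at h2
  rcases h1 with _ | ⟨c, rfl⟩ <;> rcases h2 with _ | ⟨c', rfl⟩
  · have e := Sum.inl_injective e
    exact ⟨Arc.right_injective e, e⟩
  · cases e
  · cases e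
  · cases e
    exact ⟨rfl, rfl⟩

theorem SndIn.unique (h1 : T.SndIn b h t) (h2 : T.SndIn b' h t') : b = b' ∧ t = t' := by
  generalize e : h = k at h2
  rcases h1 with ⟨c, rfl⟩ | _ <;> rcases h2 with ⟨c', rfl⟩ | _ <;> cases e <;> exact ⟨rfl, rfl⟩

theorem FstOut.eq_of_pos (h1 : T.FstOut a h t) (h2 : T.FstOut a h' t) : h = h' := by
  generalize e : t = s at h2
  rcases h1 with _ | ⟨c, rfl⟩ <;> rcases h2 with _ | ⟨c', hc⟩
  · rfl
  · exact absurd e (hc ▸ c'.left_lt_posFst.ne)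
  · exact absurd e c.left_lt_posFst.ne'
  · rw [Crossing.eq_of_posFst hc.symm e]

theorem FstIn.eq_of_pos (h1 : T.FstIn a h t) (h2 : T.FstIn a h' t) : h = h' := by
  generalize e : t = s at h2
  rcases h1 with ⟨c, rfl⟩ | ⟨b, hb⟩ | hb <;> rcases h2 with ⟨c', hc⟩ | ⟨b', hb'⟩ | hb'
  · rw [Crossing.eq_of_posFst hc.symm e]
  · exact absurd e c.posFst_lt_right.ne
  · exact absurd e c.posFst_lt_right.ne
  · exact absurd e (hc ▸ c'.posFst_lt_right.ne')
  · rw [Arc.left_injective (hb.trans hb'.symm)]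
  · exact absurd hb (hb' b)
  · exact absurd e (hc ▸ c'.posFst_lt_right.ne')
  · exact absurd hb' (hb b')
  · rfl

theorem SndOut.eq_of_pos (h1 : T.SndOut b h t) (h2 : T.SndOut b h' t) : h = h' := by
  generalize e : t = s at h2
  rcases h1 with _ | ⟨c, rfl⟩ <;> rcases h2 with _ | ⟨c', hc⟩
  · rfl
  · exact absurd e (hc ▸ c'.posSnd_lt_right.ne')
  · exact absurd e c.posSnd_lt_right.ne
  · rw [Crossing.eq_of_posSnd hc.symm e]

theorem SndIn.eq_of_pos (h1 : T.SndIn b h t) (h2 : T.SndIn b h' t) : h = h' := by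
  generalize e : t = s at h2
  rcases h1 with ⟨c, rfl⟩ | _ <;> rcases h2 with ⟨c', hc⟩ | _
  · rw [Crossing.eq_of_posSnd hc.symm e]
  · exact absurd e c.left_lt_posSnd.ne'
  · exact absurd e (hc ▸ c'.left_lt_posSnd.ne)
  · rfl

theorem exists_fstIn (ht : t = a.right ∨ ∃ c : T.Crossing, c.fst = a ∧ t = c.posFst) :
    ∃ h, T.FstIn a h t := by
  rcases ht with rfl | ⟨c, hc, rfl⟩
  · by_cases hb : ∃ b : T.Arc 1, b.left = a.right
    · obtain ⟨b, hb⟩ := hb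
      exact ⟨_, .endTri b hb⟩
    · push Not at hb
      exact ⟨_, .endBdry hb⟩
  · exact ⟨_, .cross c hc⟩

theorem exists_fstOut (ht : t = a.left ∨ ∃ c : T.Crossing, c.fst = a ∧ t = c.posFst) :
    ∃ h, T.FstOut a h t := by
  rcases ht with rfl | ⟨c, hc, rfl⟩
  · exact ⟨_, .start⟩
  · exact ⟨_, .cross c hc⟩

theorem exists_sndIn (ht : t = b.left ∨ ∃ c : T.Crossing, c.snd = b ∧ t = c.posSnd) :
    ∃ h, T.SndIn b h t := by
  rcases ht with rfl | ⟨c, hc, rfl⟩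
  · exact ⟨_, .endTri⟩
  · exact ⟨_, .cross c hc⟩

theorem exists_sndOut (ht : t = b.right ∨ ∃ c : T.Crossing, c.snd = b ∧ t = c.posSnd) :
    ∃ h, T.SndOut b h t := by
  rcases ht with rfl | ⟨c, hc, rfl⟩
  · exact ⟨_, .start⟩
  · exact ⟨_, .cross c hc⟩

/-- The edge leads to the nearest later point among the crossings of `a` and its right end. -/
theorem FstOut.exists_edge (hh : T.FstOut a h t) :
    ∃ h' t', T.FstIn a h' t' ∧ t < t' ∧ T.ResolvedEdge h h' := by
  have ht : t < a.right := by
    rcases hh.pos with rfl | ⟨c, rfl, rfl⟩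
    · exact a.left_lt_right
    · exact c.posFst_lt_right
  obtain ⟨t', ⟨h1, h2⟩, h3⟩ := wellFounded_lt.has_min
    {s : Fin μ.card | t < s ∧ (s = a.right ∨ ∃ c : T.Crossing, c.fst = a ∧ s = c.posFst)}
    ⟨a.right, ht, Or.inl rfl⟩
  obtain ⟨h', hin⟩ := exists_fstIn h2
  exact ⟨h', t', hin, h1, .alongFst a h h' t t' hh hin h1
    fun c hc hlt => h3 _ ⟨hlt.1, Or.inr ⟨c, hc, rfl⟩⟩ hlt.2⟩

theorem FstIn.exists_edge (hh : T.FstIn a h t) :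
    ∃ h' t', T.FstOut a h' t' ∧ t' < t ∧ T.ResolvedEdge h' h := by
  have ht : a.left < t := by
    rcases hh.pos with rfl | ⟨c, rfl, rfl⟩
    · exact a.left_lt_right
    · exact c.left_lt_posFst
  obtain ⟨t', ⟨h1, h2⟩, h3⟩ := wellFounded_gt.has_min
    {s : Fin μ.card | s < t ∧ (s = a.left ∨ ∃ c : T.Crossing, c.fst = a ∧ s = c.posFst)}
    ⟨a.left, ht, Or.inl rfl⟩
  obtain ⟨h', hout⟩ := exists_fstOut h2
  exact ⟨h', t', hout, h1, .alongFst a h' h t' t hout hh h1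
    fun c hc hlt => h3 _ ⟨hlt.2, Or.inr ⟨c, hc, rfl⟩⟩ hlt.1⟩

theorem SndOut.exists_edge (hh : T.SndOut b h t) :
    ∃ h' t', T.SndIn b h' t' ∧ t' < t ∧ T.ResolvedEdge h h' := by
  have ht : b.left < t := by
    rcases hh.pos with rfl | ⟨c, rfl, rfl⟩
    · exact b.left_lt_right
    · exact c.left_lt_posSnd
  obtain ⟨t', ⟨h1, h2⟩, h3⟩ := wellFounded_gt.has_min
    {s : Fin μ.card | s < t ∧ (s = b.left ∨ ∃ c : T.Crossing, c.snd = b ∧ s = c.posSnd)}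
    ⟨b.left, ht, Or.inl rfl⟩
  obtain ⟨h', hin⟩ := exists_sndIn h2
  exact ⟨h', t', hin, h1, .alongSnd b h h' t t' hh hin h1
    fun c hc hlt => h3 _ ⟨hlt.2, Or.inr ⟨c, hc, rfl⟩⟩ hlt.1⟩

theorem SndIn.exists_edge (hh : T.SndIn b h t) :
    ∃ h' t', T.SndOut b h' t' ∧ t < t' ∧ T.ResolvedEdge h' h := by
  have ht : t < b.right := by
    rcases hh.pos with rfl | ⟨c, rfl, rfl⟩
    · exact b.left_lt_right
    · exact c.posSnd_lt_right
  obtain ⟨t', ⟨h1, h2⟩, h3⟩ := wellFounded_lt.has_min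
    {s : Fin μ.card | t < s ∧ (s = b.right ∨ ∃ c : T.Crossing, c.snd = b ∧ s = c.posSnd)}
    ⟨b.right, ht, Or.inl rfl⟩
  obtain ⟨h', hout⟩ := exists_sndOut h2
  exact ⟨h', t', hout, h1, .alongSnd b h' h t' t hout hh h1
    fun c hc hlt => h3 _ ⟨hlt.1, Or.inr ⟨c, hc, rfl⟩⟩ hlt.2⟩

end

open Classical in
/-- The kind of a half-edge: `0` and `1` for the beginning and the end of a piece of a first arc,
`2` and `3` for those of a piece of a second arc, `4` and `5` for those of a remaining edge. -/
noncomputable def kind (T : StandardTableau μ) : T.ResolvedHalfEdge → ℕ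
  | Sum.inl i => if T.row i = 0 then 0 else if T.row i = 2 then 2 else
      if ∃ b : T.Arc 1, b.left = i then 4 else 1
  | Sum.inr (InnerVertex.source _, Slot.first) => 0
  | Sum.inr (InnerVertex.source _, Slot.second) => 2
  | Sum.inr (InnerVertex.source _, Slot.third) => 4
  | Sum.inr (_, Slot.first) => 1
  | Sum.inr (_, Slot.second) => 3
  | Sum.inr (_, Slot.third) => 5

theorem FstOut.kind_eq {a : T.Arc 0} {h : T.ResolvedHalfEdge} {t : Fin μ.card}
    (hh : T.FstOut a h t) : T.kind h = 0 := by
  rcases hh with _ | ⟨c, rfl⟩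
  · exact if_pos a.row_left
  · rfl

theorem FstIn.kind_eq {a : T.Arc 0} {h : T.ResolvedHalfEdge} {t : Fin μ.card}
    (hh : T.FstIn a h t) : T.kind h = 1 := by
  rcases hh with ⟨c, rfl⟩ | ⟨b, hb⟩ | hb
  · rfl
  · rfl
  · simp [kind, a.row_right, hb]

theorem SndOut.kind_eq {b : T.Arc 1} {h : T.ResolvedHalfEdge} {t : Fin μ.card}
    (hh : T.SndOut b h t) : T.kind h = 2 := by
  rcases hh with _ | ⟨c, rfl⟩
  · simp [kind, b.row_right]
  · rfl

theorem SndIn.kind_eq {b : T.Arc 1} {h : T.ResolvedHalfEdge} {t : Fin μ.card}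
    (hh : T.SndIn b h t) : T.kind h = 3 := by
  rcases hh with ⟨c, rfl⟩ | _ <;> rfl

theorem kind_stem (b : T.Arc 1) : T.kind (Sum.inl b.left) = 4 := by
  simp [kind, b.row_left]

theorem ResolvedEdge.kind_eq {h h' : T.ResolvedHalfEdge} (hh : T.ResolvedEdge h h') :
    T.kind h' = T.kind h + 1 ∧ T.kind h % 2 = 0 := by
  rcases hh with ⟨a, _, _, t, t', hout, hin, hlt, hcons⟩ | ⟨b, _, _, t, t', hout, hin, hlt, hcons⟩ |
    b | c
  · rw [hout.kind_eq, hin.kind_eq]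
    omega
  · rw [hout.kind_eq, hin.kind_eq]
    omega
  · rw [kind_stem]
    exact ⟨rfl, rfl⟩
  · exact ⟨rfl, (rfl : 4 % 2 = 0)⟩

/-- The kind of `h` forces both edges to come from the same constructor. On an arc, of two different
successors the nearer would be a crossing strictly inside the piece leading to the farther one. -/
theorem ResolvedEdge.right_unique {h h₁ h₂ : T.ResolvedHalfEdge} (H₁ : T.ResolvedEdge h h₁)
    (H₂ : T.ResolvedEdge h h₂) : h₁ = h₂ := by
  generalize e : h = k at H₂
  have hk : T.kind h = T.kind k := congrArg _ e
  rcases H₁ with ⟨a, _, _, t, t', hout, hin, hlt, hcons⟩ | ⟨b, _, _, t, t', hout, hin, hlt, hcons⟩ |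
    b | c <;>
  rcases H₂ with ⟨a', _, _, s, s', kout, kin, klt, kcons⟩ |
    ⟨b', _, _, s, s', kout, kin, klt, kcons⟩ | b' | c' <;>
  (try rw [hout.kind_eq] at hk) <;> (try rw [kout.kind_eq] at hk) <;>
  try first
    | (cases hk; done)
    | (cases e; done)
    | (simp [kind_stem] at hk; done)
    | (simp [kind] at hk; done)
  · obtain ⟨rfl, rfl⟩ := hout.unique (e ▸ kout)
    obtain rfl : t' = s' := by
      rcases lt_trichotomy t' s' with h | h | h
      · rcases hin.pos with rfl | ⟨c, hc, rfl⟩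
        · rcases kin.pos with rfl | ⟨c', rfl, rfl⟩
          · rfl
          · exact absurd h c'.posFst_lt_right.asymm
        · exact absurd ⟨hlt, h⟩ (kcons c hc)
      · exact h
      · rcases kin.pos with rfl | ⟨c, hc, rfl⟩
        · rcases hin.pos with rfl | ⟨c', rfl, rfl⟩
          · rfl
          · exact absurd h c'.posFst_lt_right.asymm
        · exact absurd ⟨klt, h⟩ (hcons c hc)
    exact hin.eq_of_pos kin
  · obtain ⟨rfl, rfl⟩ := hout.unique (e ▸ kout)
    obtain rfl : t' = s' := by
      rcases lt_trichotomy t' s' with h | h | h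
      · rcases kin.pos with rfl | ⟨c, hc, rfl⟩
        · rcases hin.pos with rfl | ⟨c', rfl, rfl⟩
          · rfl
          · exact absurd h c'.left_lt_posSnd.asymm
        · exact absurd ⟨h, klt⟩ (hcons c hc)
      · exact h
      · rcases hin.pos with rfl | ⟨c, hc, rfl⟩
        · rcases kin.pos with rfl | ⟨c', rfl, rfl⟩
          · rfl
          · exact absurd h c'.left_lt_posSnd.asymm
        · exact absurd ⟨h, hlt⟩ (kcons c hc)
    exact hin.eq_of_pos kin
  · rw [Arc.left_injective (Sum.inl_injective e)]
  · cases e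
    rfl

theorem ResolvedEdge.left_unique {h h₁ h₂ : T.ResolvedHalfEdge} (H₁ : T.ResolvedEdge h₁ h)
    (H₂ : T.ResolvedEdge h₂ h) : h₁ = h₂ := by
  generalize e : h = k at H₂
  have hk : T.kind h = T.kind k := congrArg _ e
  rcases H₁ with ⟨a, _, _, t, t', hout, hin, hlt, hcons⟩ | ⟨b, _, _, t, t', hout, hin, hlt, hcons⟩ |
    b | c <;>
  rcases H₂ with ⟨a', _, _, s, s', kout, kin, klt, kcons⟩ |
    ⟨b', _, _, s, s', kout, kin, klt, kcons⟩ | b' | c' <;>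
  (try rw [hin.kind_eq] at hk) <;> (try rw [kin.kind_eq] at hk) <;>
  try first
    | (cases hk; done)
    | (cases e; done)
    | (simp at hk; done)
    | (simp [kind] at hk; done)
  · obtain ⟨rfl, rfl⟩ := hin.unique (e ▸ kin)
    obtain rfl : t = s := by
      rcases lt_trichotomy t s with h | h | h
      · rcases kout.pos with rfl | ⟨c, hc, rfl⟩
        · rcases hout.pos with rfl | ⟨c', rfl, rfl⟩
          · rfl
          · exact absurd h c'.left_lt_posFst.asymm
        · exact absurd ⟨h, klt⟩ (hcons c hc)
      · exact h
      · rcases hout.pos with rfl | ⟨c, hc, rfl⟩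
        · rcases kout.pos with rfl | ⟨c', rfl, rfl⟩
          · rfl
          · exact absurd h c'.left_lt_posFst.asymm
        · exact absurd ⟨h, hlt⟩ (kcons c hc)
    exact hout.eq_of_pos kout
  · obtain ⟨rfl, rfl⟩ := hin.unique (e ▸ kin)
    obtain rfl : t = s := by
      rcases lt_trichotomy t s with h | h | h
      · rcases hout.pos with rfl | ⟨c, hc, rfl⟩
        · rcases kout.pos with rfl | ⟨c', rfl, rfl⟩
          · rfl
          · exact absurd h c'.posSnd_lt_right.asymm
        · exact absurd ⟨hlt, h⟩ (kcons c hc)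
      · exact h
      · rcases kout.pos with rfl | ⟨c, hc, rfl⟩
        · rcases hout.pos with rfl | ⟨c', rfl, rfl⟩
          · rfl
          · exact absurd h c'.posSnd_lt_right.asymm
        · exact absurd ⟨klt, h⟩ (hcons c hc)
    exact hout.eq_of_pos kout
  · cases e
    rfl
  · cases e
    rfl

/-- Equality of the two long rows enters here: without it a bottom-row number could be isolated and
carry a dangling half-edge. -/
theorem exists_opp (hμ : IsThreeRow μ) (h : T.ResolvedHalfEdge) :
    ∃ h', T.ResolvedEdge h h' ∨ T.ResolvedEdge h' h := by
  rcases h with i | ⟨b | c | c, _ | _ | _⟩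
  · have hi := T.row_lt_three hμ i
    obtain h0 | h1 | h2 : T.row i = 0 ∨ T.row i = 1 ∨ T.row i = 2 := by omega
    · obtain ⟨a, rfl⟩ := exists_arc_left hμ.rowLen_one h0
      obtain ⟨h', _, _, _, hh⟩ := (FstOut.start (a := a)).exists_edge
      exact ⟨h', Or.inl hh⟩
    · by_cases hb : ∃ b : T.Arc 1, b.left = i
      · obtain ⟨b, rfl⟩ := hb
        exact ⟨_, Or.inl (.stem b)⟩
      · push Not at hb
        obtain ⟨a, rfl⟩ := exists_arc_right h1
        obtain ⟨h', _, _, _, hh⟩ := (FstIn.endBdry hb).exists_edge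
        exact ⟨h', Or.inr hh⟩
    · obtain ⟨b, rfl⟩ := exists_arc_right h2
      obtain ⟨h', _, _, _, hh⟩ := (SndOut.start (b := b)).exists_edge
      exact ⟨h', Or.inl hh⟩
  · obtain ⟨a, ha⟩ := exists_arc_right b.row_left
    obtain ⟨h', _, _, _, hh⟩ := (FstIn.endTri b ha.symm).exists_edge
    exact ⟨h', Or.inr hh⟩
  · obtain ⟨h', _, _, _, hh⟩ := (SndIn.endTri (b := b)).exists_edge
    exact ⟨h', Or.inr hh⟩
  · exact ⟨_, Or.inr (.stem b)⟩
  · obtain ⟨h', _, _, _, hh⟩ := (FstIn.cross c rfl).exists_edge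
    exact ⟨h', Or.inr hh⟩
  · obtain ⟨h', _, _, _, hh⟩ := (SndIn.cross c rfl).exists_edge
    exact ⟨h', Or.inr hh⟩
  · exact ⟨_, Or.inr (.resolve c)⟩
  · obtain ⟨h', _, _, _, hh⟩ := (FstOut.cross c rfl).exists_edge
    exact ⟨h', Or.inl hh⟩
  · obtain ⟨h', _, _, _, hh⟩ := (SndOut.cross c rfl).exists_edge
    exact ⟨h', Or.inl hh⟩
  · exact ⟨_, Or.inl (.resolve c)⟩

theorem opp_unique {h h₁ h₂ : T.ResolvedHalfEdge} (H₁ : T.ResolvedEdge h h₁ ∨ T.ResolvedEdge h₁ h)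
    (H₂ : T.ResolvedEdge h h₂ ∨ T.ResolvedEdge h₂ h) : h₁ = h₂ := by
  rcases H₁ with H₁ | H₁ <;> rcases H₂ with H₂ | H₂
  · exact H₁.right_unique H₂
  · have := H₁.kind_eq
    have := H₂.kind_eq
    omega
  · have := H₁.kind_eq
    have := H₂.kind_eq
    omega
  · exact H₁.left_unique H₂

/-! #### Local conditions -/

/-- The inner vertices are the vertices of the `Y`s and two vertices for each crossing. -/
def innerVertexEquiv (T : StandardTableau μ) :
    T.InnerVertex ≃ T.Arc 1 ⊕ (T.Crossing ⊕ T.Crossing) where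
  toFun
    | .tri b => Sum.inl b
    | .sink c => Sum.inr (Sum.inl c)
    | .source c => Sum.inr (Sum.inr c)
  invFun
    | Sum.inl b => .tri b
    | Sum.inr (Sum.inl c) => .sink c
    | Sum.inr (Sum.inr c) => .source c
  left_inv v := by cases v <;> rfl
  right_inv v := by rcases v with b | c | c <;> rfl

/-- An enumeration of the three slots. -/
def slotEquiv : Slot ≃ Option Bool where
  toFun
    | .first => some false
    | .second => some true
    | .third => none
  invFun
    | some false => .first
    | some true => .second
    | none => .third
  left_inv s := by cases s <;> rfl
  right_inv s := by rcases s with _ | _ | _ <;> rfl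

instance : Finite Slot := Finite.of_equiv _ slotEquiv.symm

instance : Finite T.InnerVertex := Finite.of_equiv _ T.innerVertexEquiv.symm

theorem card_innerVertex (T : StandardTableau μ) :
    Nat.card T.InnerVertex = Nat.card (T.Arc 1) + 2 * Nat.card T.Crossing := by
  rw [Nat.card_congr T.innerVertexEquiv, Nat.card_sum, Nat.card_sum]
  omega

theorem card_resolvedHalfEdge (T : StandardTableau μ) :
    Nat.card T.ResolvedHalfEdge =
      μ.card + (Nat.card (T.Arc 1) + 2 * Nat.card T.Crossing) * 3 := by
  rw [Nat.card_sum, Nat.card_prod, card_innerVertex, Nat.card_congr slotEquiv, Nat.card_fin]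
  simp

theorem isMap (hμ : IsThreeRow μ) (T : StandardTableau μ) : T.resolvedMDiagram.IsMap where
  finite := inferInstanceAs (Finite T.ResolvedHalfEdge)
  opp_symm := fun _ _ h => h.symm
  opp_ne := by
    rintro h h' hh rfl
    rcases hh with hh | hh <;> have := hh.kind_eq <;> omega
  opp_unique := fun h => by
    obtain ⟨h', hh⟩ := exists_opp hμ h
    exact ⟨h', hh, fun k hk => opp_unique hk hh⟩
  bdry_injective := Sum.inl_injective
  univalent := fun _ => rfl
  trivalent := by
    rintro (i | ⟨b | c | c, s⟩) hh
    · exact absurd rfl (hh i)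
    · refine ⟨?_, ?_⟩ <;> cases s <;> simp [resolvedMDiagram, resolvedRot, Slot.prev]
    all_goals
      refine ⟨?_, ?_⟩ <;> cases s <;> by_cases hc : c.fst.left < c.snd.left <;>
        simp [resolvedMDiagram, resolvedRot, crossingRot, hc, Slot.prev, Slot.next]

theorem ResolvedEdge.out {h h' : T.ResolvedHalfEdge} (hh : T.ResolvedEdge h h') :
    T.ResolvedOut h ∧ ¬ T.ResolvedOut h' := by
  rcases hh with ⟨a, _, _, t, t', hout, hin, hlt, hcons⟩ | ⟨b, _, _, t, t', hout, hin, hlt, hcons⟩ |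
    b | c
  · constructor
    · rcases hout with _ | ⟨c, rfl⟩
      · intro h
        rw [a.row_left] at h
        cases h
      · trivial
    · rcases hin with ⟨c, rfl⟩ | ⟨b, hb⟩ | hb
      · exact id
      · exact id
      · intro h
        obtain ⟨b, h⟩ := h a.row_right
        exact hb b h
  · constructor
    · rcases hout with _ | ⟨c, rfl⟩
      · intro h
        rw [b.row_right] at h
        cases h
      · trivial
    · rcases hin with ⟨c, rfl⟩ | _
      · exact id
      · exact id
  · exact ⟨fun _ => ⟨b, rfl⟩, id⟩
  · exact ⟨trivial, id⟩

/-! #### Connectedness -/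

/-- Two darts lie in the same component of the graph together with the boundary line. -/
abbrev Connected (T : StandardTableau μ) (d e : T.resolvedMDiagram.Dart) : Prop :=
  Relation.EqvGen
    (fun x y => T.resolvedMDiagram.RotStep x y ∨ T.resolvedMDiagram.Link x y) d e

theorem connected_segment (b : Bool) (p : Fin (μ.card + 1)) :
    T.Connected (Sum.inr (0, false)) (Sum.inr (p, b)) := by
  have hb : ∀ p b, T.Connected (Sum.inr (p, false)) (Sum.inr (p, b)) := by
    intro p b
    cases b
    · exact .refl _
    · exact .rel _ _ (Or.inr (.segment p false))
  induction p using Fin.induction with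
  | zero => exact hb _ _
  | succ i ih =>
    have ih := ih.trans _ _ _ (((hb _ b).symm).trans _ _ _ (hb _ true))
    exact (ih.trans _ _ _ (.rel _ _ (Or.inl (.left i)))).trans _ _ _ (hb _ _)

theorem connected_bdry (i : Fin μ.card) :
    T.Connected (Sum.inr (0, false)) (Sum.inl (Sum.inl i : T.ResolvedHalfEdge)) :=
  (connected_segment false i.succ).trans _ _ _ (.rel _ _ (Or.inl (.right i)))

theorem connected_rot (v : T.InnerVertex) (s s' : Slot) :
    T.Connected (Sum.inl (Sum.inr (v, s) : T.ResolvedHalfEdge))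
      (Sum.inl (Sum.inr (v, s') : T.ResolvedHalfEdge)) := by
  have key : ∀ s, T.Connected (Sum.inl (Sum.inr (v, s) : T.ResolvedHalfEdge))
      (Sum.inl (T.resolvedRot (Sum.inr (v, s)) : T.ResolvedHalfEdge)) := fun s =>
    .rel _ _ (Or.inl (.inner (G := T.resolvedMDiagram) (Sum.inr (v, s) : T.ResolvedHalfEdge)
      fun i h => by cases h))
  suffices h : ∀ s, T.Connected (Sum.inl (Sum.inr (v, .third) : T.ResolvedHalfEdge))
      (Sum.inl (Sum.inr (v, s) : T.ResolvedHalfEdge)) from ((h s).symm).trans _ _ _ (h s')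
  rcases v with b | c | c
  · have h1 := key .first
    have h2 := key .second
    intro s
    cases s
    · exact h1.symm
    · exact (h2.trans _ _ _ h1).symm
    · exact .refl _
  all_goals
    have h1 := key .first
    have h2 := key .second
    have h3 := key .third
    by_cases hc : c.fst.left < c.snd.left
    · simp only [resolvedRot, crossingRot, if_pos hc, Slot.prev] at h1 h2 h3
      intro s
      cases s
      · exact h1.symm
      · exact h3
      · exact .refl _
    · simp only [resolvedRot, crossingRot, if_neg hc, Slot.next] at h1 h2 h3
      intro s
      cases s
      · exact h3
      · exact h2.symm
      · exact .refl _

theorem connected_edge {h h' : T.ResolvedHalfEdge} (hh : T.ResolvedEdge h h') :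
    T.Connected (Sum.inl h) (Sum.inl h') :=
  .rel _ _ (Or.inr (.edge (G := T.resolvedMDiagram) h h' (Or.inl hh)))

/-- Following the first arc backwards from the crossing leads to its boundary point or to the source
of an earlier crossing. The latter is joined to its own sink, so induction on the position applies.
-/
theorem connected_sink (m : ℕ) (c : T.Crossing) (hm : (c.posFst : ℕ) = m) (s : Slot) :
    T.Connected (Sum.inr (0, false))
      (Sum.inl (Sum.inr (InnerVertex.sink c, s) : T.ResolvedHalfEdge)) := by
  induction m using Nat.strong_induction_on generalizing c s with
  | _ m ih =>
    obtain ⟨h', t', hout, hlt, hh⟩ := (FstIn.cross c rfl).exists_edge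
    refine Relation.EqvGen.trans _ _ _ ?_ (connected_rot _ .first s)
    refine Relation.EqvGen.trans _ _ _ ?_ (connected_edge hh)
    rcases hout with _ | ⟨c', hc⟩
    · exact connected_bdry _
    · refine Relation.EqvGen.trans _ _ _ ?_ (connected_rot _ .third .first)
      refine Relation.EqvGen.trans _ _ _ ?_ (connected_edge (.resolve c')).symm
      exact ih _ (hm ▸ hlt) c' rfl _

theorem connected (T : StandardTableau μ) (d e : T.resolvedMDiagram.Dart) : T.Connected d e := by
  suffices h : ∀ d, T.Connected (Sum.inr (0, false)) d from ((h d).symm).trans _ _ _ (h e)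
  rintro (h | ⟨p, b⟩)
  · change T.ResolvedHalfEdge at h
    rcases h with i | ⟨b | c | c, s⟩
    · exact connected_bdry i
    · exact ((connected_bdry _).trans _ _ _ (connected_edge (.stem b))).trans _ _ _
        (connected_rot _ _ _)
    · exact connected_sink _ c rfl s
    · exact ((connected_sink _ c rfl .third).trans _ _ _
        (connected_edge (.resolve c)).symm).trans _ _ _ (connected_rot _ _ _)
  · exact connected_segment b p

/-! #### Euler's formula -/

/-- The vertex of a dart; `none` is the point at infinity. -/
def dartVertex (T : StandardTableau μ) :
    T.resolvedMDiagram.Dart → Option (Fin μ.card ⊕ T.InnerVertex)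
  | Sum.inl (Sum.inl i) => some (Sum.inl i)
  | Sum.inl (Sum.inr (v, _)) => some (Sum.inr v)
  | Sum.inr (p, false) =>
    Fin.cases (motive := fun _ => Option (Fin μ.card ⊕ T.InnerVertex)) none
      (fun i => some (Sum.inl i)) p
  | Sum.inr (p, true) =>
    Fin.lastCases (motive := fun _ => Option (Fin μ.card ⊕ T.InnerVertex)) none
      (fun i => some (Sum.inl i)) p

theorem dartVertex_of_rotStep {d e : T.resolvedMDiagram.Dart}
    (h : T.resolvedMDiagram.RotStep d e) : T.dartVertex d = T.dartVertex e := by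
  rcases h with ⟨h, hh⟩ | i | i | i | _ | _
  · change T.ResolvedHalfEdge at h
    rcases h with i | ⟨b | c | c, s⟩
    · exact absurd rfl (hh i)
    all_goals rfl
  all_goals simp [dartVertex, resolvedMDiagram]

theorem card_le_card_vertex (hμ : IsThreeRow μ) (T : StandardTableau μ) :
    μ.card + (Nat.card (T.Arc 1) + 2 * Nat.card T.Crossing) + 1 ≤
      Nat.card T.resolvedMDiagram.Vertex := by
  have := (T.isMap hμ).finite_dart
  have : Finite T.resolvedMDiagram.Vertex := Quot.finite _
  let f : T.resolvedMDiagram.Vertex → Option (Fin μ.card ⊕ T.InnerVertex) :=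
    Quot.lift T.dartVertex fun _ _ => dartVertex_of_rotStep
  have hf : Function.Surjective f := by
    rintro (_ | i | v)
    · exact ⟨Quot.mk _ (Sum.inr (0, false)), rfl⟩
    · exact ⟨Quot.mk _ (Sum.inl (Sum.inl i : T.ResolvedHalfEdge)), rfl⟩
    · exact ⟨Quot.mk _ (Sum.inl (Sum.inr (v, .first) : T.ResolvedHalfEdge)), rfl⟩
  have h := Nat.card_le_card_of_surjective f hf
  rwa [Finite.card_option, Nat.card_sum, Nat.card_fin, card_innerVertex] at h

theorem two_mul_card_edge (hμ : IsThreeRow μ) (T : StandardTableau μ) :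
    2 * Nat.card T.resolvedMDiagram.Edge =
      μ.card + (Nat.card (T.Arc 1) + 2 * Nat.card T.Crossing) * 3 + (μ.card + 1) * 2 := by
  have h := (T.isMap hμ).finite
  rw [← (T.isMap hμ).card_dart, Nat.card_sum, Nat.card_prod, Nat.card_fin,
    ← card_resolvedHalfEdge, Nat.card_eq_fintype_card (α := Bool), Fintype.card_bool]
  rfl

/-- The face with a given peak. -/
noncomputable def peakFace (T : StandardTableau μ)
    (x : Bool ⊕ (T.Arc 0 ⊕ (T.Arc 1 ⊕ T.Crossing))) : T.resolvedMDiagram.Face :=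
  T.resolvedMDiagram.face (exists_peak x).choose

theorem faceLabel_peakFace (x : Bool ⊕ (T.Arc 0 ⊕ (T.Arc 1 ⊕ T.Crossing))) :
    T.faceLabel (T.peakFace x) = T.peakLabel x := (exists_peak x).choose_spec.1

theorem peakFace_injective : Function.Injective T.peakFace := fun x y h =>
  peakLabel_injective (by rw [← faceLabel_peakFace, ← faceLabel_peakFace, h])

/-- With `k` first arcs, `n` second arcs and `x` crossings, `E = 3k + 3n + 3x + 1`, `V ≥ 2k + 2n +
2x + 1` and `F ≥ k + n + x + 2`. The lower bounds already add up to `E + 2`, so the genus inequality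
forces equality in both. -/
theorem euler_and_card_face (hμ : IsThreeRow μ) (T : StandardTableau μ) :
    Nat.card T.resolvedMDiagram.Vertex + Nat.card T.resolvedMDiagram.Face =
      Nat.card T.resolvedMDiagram.Edge + 2 ∧
    Nat.card T.resolvedMDiagram.Face =
      Nat.card (Bool ⊕ (T.Arc 0 ⊕ (T.Arc 1 ⊕ T.Crossing))) := by
  have := (T.isMap hμ).finite_dart
  have : Finite T.resolvedMDiagram.Face := Quot.finite _
  have h1 := T.card_le_card_vertex hμ
  have h2 := T.two_mul_card_edge hμ
  have h3 := Nat.card_le_card_of_injective _ (peakFace_injective (T := T))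
  have h4 := (T.isMap hμ).card_vertex_add_card_face_le T.connected
  have h5 := T.card_eq_rowLen hμ
  have h6 : _ = μ.rowLen 1 := T.card_arc 0
  have h7 : _ = μ.rowLen 2 := T.card_arc 1
  have h8 := hμ.rowLen_one
  simp only [Nat.card_sum, Nat.card_eq_fintype_card (α := Bool), Fintype.card_bool] at h3 ⊢
  omega

theorem isWeb (hμ : IsThreeRow μ) (T : StandardTableau μ) : T.resolvedMDiagram.IsWeb where
  finite := (T.isMap hμ).finite
  opp_symm := (T.isMap hμ).opp_symm
  opp_ne := (T.isMap hμ).opp_ne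
  opp_unique := (T.isMap hμ).opp_unique
  bdry_injective := (T.isMap hμ).bdry_injective
  univalent := (T.isMap hμ).univalent
  trivalent := (T.isMap hμ).trivalent
  directed := by
    rintro h h' (hh | hh)
    · exact iff_of_true hh.out.1 hh.out.2
    · exact iff_of_false hh.out.2 (not_not.2 hh.out.1)
  source_or_sink := by
    rintro (i | ⟨b | c | c, s⟩) <;> exact Iff.rfl
  connected := T.connected
  euler := (T.euler_and_card_face hμ).1

theorem peakFace_bijective (hμ : IsThreeRow μ) : Function.Bijective T.peakFace := by
  have := (T.isMap hμ).finite_dart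
  have : Finite T.resolvedMDiagram.Face := Quot.finite _
  exact peakFace_injective.bijective_of_nat_card_le (T.euler_and_card_face hμ).2.le

/-- Every bounded face above the line has an arc on its upper side. -/
theorem exists_top_of_face (hμ : IsThreeRow μ) (f : T.resolvedMDiagram.Face) :
    f = T.resolvedMDiagram.face (Sum.inr (0, true)) ∨ f = T.resolvedMDiagram.unboundedFace ∨
      ∃ h : T.ResolvedHalfEdge, T.IsTop h ∧ f = T.resolvedMDiagram.face (Sum.inl h) := by
  obtain ⟨x, rfl⟩ := (peakFace_bijective hμ).surjective f
  rcases (exists_peak x).choose_spec.2 with h | h | ⟨h, h1, h2⟩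
  · exact Or.inl (congrArg _ h)
  · exact Or.inr (Or.inl (congrArg _ h))
  · exact Or.inr (Or.inr ⟨h, h1, congrArg _ h2⟩)

end StandardTableau

/-! ### Depth in resolved diagrams -/

namespace StandardTableau

variable {μ : YoungDiagram} {T : StandardTableau μ}

/-- The number of arcs in a label. -/
noncomputable def labelCard (p : Set (T.Arc 0) × Set (T.Arc 1)) : ℕ := p.1.ncard + p.2.ncard

theorem ncard_cover_left_succ {r : ℕ} (a : T.Arc r) :
    (T.cover r (a.left + 1)).ncard = (T.cover r a.left).ncard + 1 := by
  rw [cover_left_succ, Set.ncard_insert_of_notMem (notMem_cover_left a) (Set.toFinite _)]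

theorem ncard_cover_right {r : ℕ} (a : T.Arc r) :
    (T.cover r a.right).ncard = (T.cover r (a.right + 1)).ncard + 1 := by
  rw [cover_right, cover_right_succ, ncard_cover_left_succ]

/-- The left foot of a second arc is the right foot of a first arc, so a first arc closes there
while the second arc opens. -/
theorem ncard_cover_fst_stem (b : T.Arc 1) :
    (T.cover 0 b.left).ncard = (T.cover 0 (b.left + 1)).ncard + 1 := by
  obtain ⟨a, ha⟩ := exists_arc_right b.row_left
  rw [← ha, ncard_cover_right]

/-- Crossing an edge changes the number of arcs above by at most one. -/
theorem ResolvedEdge.labelCard_le {h h' : T.ResolvedHalfEdge} (hh : T.ResolvedEdge h h') :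
    labelCard (T.halfLabel h) ≤ labelCard (T.halfLabel h') + 1 ∧
      labelCard (T.halfLabel h') ≤ labelCard (T.halfLabel h) + 1 := by
  rw [hh.labels.2]
  rcases hh with ⟨a, _, _, t, t', hout, hin, hlt, hcons⟩ | ⟨b, _, _, t, t', hout, hin, hlt, hcons⟩ |
    b | c
  · rw [hout.labels.1, hout.labels.2]
    simp only [labelCard, ncard_cover_left_succ]
    omega
  · rw [hout.labels.1, hout.labels.2]
    simp only [labelCard, ncard_cover_left_succ]
    omega
  -- Across a stem one first arc is exchanged for one second arc, and the total stays the same.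
  · simp only [halfLabel, halfRight, labelCard, ncard_cover_fst_stem, ncard_cover_left_succ]
    omega
  -- Of the two crossing arcs, one side of the new edge is under the first only and the other under
  -- the second only.
  · simp only [halfLabel, halfRight, labelCard, ncard_cover_left_succ]
    omega

/-- Crossing an arc upwards decreases the number of arcs above. -/
theorem IsTop.exists_opp {h : T.ResolvedHalfEdge} (hh : T.IsTop h) :
    ∃ h', (T.ResolvedEdge h h' ∨ T.ResolvedEdge h' h) ∧
      labelCard (T.halfLabel h) = labelCard (T.halfLabel h') + 1 := by
  rcases hh with ⟨a, t, hh⟩ | ⟨b, t, hh⟩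
  · obtain ⟨h', _, _, _, he⟩ := hh.exists_edge
    refine ⟨h', Or.inr he, ?_⟩
    rw [he.labels.1, hh.labels.1, hh.labels.2]
    simp only [labelCard, ncard_cover_left_succ]
    omega
  · obtain ⟨h', _, _, _, he⟩ := hh.exists_edge
    refine ⟨h', Or.inl he, ?_⟩
    rw [he.labels.2, hh.labels.1, hh.labels.2]
    simp only [labelCard, ncard_cover_left_succ]
    omega

/-- The number of arcs above a face. -/
noncomputable def faceCard (f : T.resolvedMDiagram.Face) : ℕ := (T.faceLabel f).elim 0 labelCard

theorem faceCard_face (h : T.ResolvedHalfEdge) :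
    faceCard (T.resolvedMDiagram.face (Sum.inl h)) = labelCard (T.halfLabel h) := rfl

theorem faceCard_segment (p : Fin (μ.card + 1)) :
    faceCard (T.resolvedMDiagram.face (Sum.inr (p, false))) =
      (T.cover 0 p).ncard + (T.cover 1 p).ncard := rfl

theorem faceCard_le_of_adj {f g : T.resolvedMDiagram.Face}
    (h : T.resolvedMDiagram.dualGraph.Adj f g) : faceCard f ≤ faceCard g + 1 := by
  rcases h.2 with ⟨h, h', hh, rfl, rfl⟩ | ⟨h, h', hh, rfl, rfl⟩ <;>
  rcases hh with hh | hh
  · exact hh.labelCard_le.1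
  · exact hh.labelCard_le.2
  · exact hh.labelCard_le.2
  · exact hh.labelCard_le.1

theorem faceCard_le_of_walk {f g : T.resolvedMDiagram.Face}
    (w : T.resolvedMDiagram.dualGraph.Walk f g) : faceCard f ≤ faceCard g + w.length := by
  induction w with
  | nil => simp
  | cons h w ih =>
    have := faceCard_le_of_adj h
    rw [SimpleGraph.Walk.length_cons]
    omega

theorem faceCard_unboundedFace : faceCard T.resolvedMDiagram.unboundedFace = 0 := by
  change faceCard (T.resolvedMDiagram.face (Sum.inr (0, false))) = 0
  rw [faceCard_segment]
  simp [cover_zero]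

/-- Repeatedly leaving a face through an edge on its upper side removes one overhead arc each time.
The face below the line must be excluded, as it has no label. -/
theorem exists_walk (hμ : IsThreeRow μ) (m : ℕ) (f : T.resolvedMDiagram.Face)
    (hf : T.faceLabel f ≠ none) (hm : faceCard f = m) :
    ∃ w : T.resolvedMDiagram.dualGraph.Walk f T.resolvedMDiagram.unboundedFace, w.length ≤ m := by
  induction m using Nat.strong_induction_on generalizing f with
  | _ m ih =>
    rcases exists_top_of_face hμ f with rfl | rfl | ⟨h, htop, rfl⟩
    · exact absurd rfl hf
    · exact ⟨.nil, Nat.zero_le _⟩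
    · obtain ⟨h', hh, hcard⟩ := htop.exists_opp
      rw [faceCard_face] at hm
      obtain ⟨w, hw⟩ := ih (labelCard (T.halfLabel h')) (by omega)
        (T.resolvedMDiagram.face (Sum.inl h')) (fun e => by cases e) (faceCard_face h')
      have hadj : T.resolvedMDiagram.dualGraph.Adj (T.resolvedMDiagram.face (Sum.inl h))
          (T.resolvedMDiagram.face (Sum.inl h')) := by
        refine ⟨fun e => ?_, Or.inl ⟨h, h', hh, rfl, rfl⟩⟩
        have e := congrArg faceCard e
        rw [faceCard_face, faceCard_face] at e
        omega
      refine ⟨.cons hadj w, ?_⟩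
      rw [SimpleGraph.Walk.length_cons]
      omega

/-- The depth of a face above the line is the number of arcs above it. -/
theorem depth_eq (hμ : IsThreeRow μ) {f : T.resolvedMDiagram.Face} (hf : T.faceLabel f ≠ none) :
    T.resolvedMDiagram.depth f = faceCard f := by
  obtain ⟨w, hw⟩ := exists_walk hμ _ f hf rfl
  refine le_antisymm ((SimpleGraph.dist_le w).trans hw) ?_
  obtain ⟨w', hw'⟩ := w.reachable.exists_walk_length_eq_dist
  have := faceCard_le_of_walk w'
  rwa [faceCard_unboundedFace, zero_add, hw'] at this

theorem depth_faceLeft (hμ : IsThreeRow μ) (i : Fin μ.card) :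
    T.resolvedMDiagram.depth (T.resolvedMDiagram.faceLeft i) =
      (T.cover 0 i).ncard + (T.cover 1 i).ncard :=
  depth_eq hμ fun e => by cases e

theorem depth_faceRight (hμ : IsThreeRow μ) (i : Fin μ.card) :
    T.resolvedMDiagram.depth (T.resolvedMDiagram.faceRight i) =
      (T.cover 0 (i + 1)).ncard + (T.cover 1 (i + 1)).ncard :=
  depth_eq hμ fun e => by cases e

/-- The extended depth map recovers a tableau from its resolved diagram. -/
theorem isExtendedDepthTableau (hμ : IsThreeRow μ) (T : StandardTableau μ) :
    T.resolvedMDiagram.IsExtendedDepthTableau T := by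
  intro i
  have hsrc : T.resolvedMDiagram.IsSource i ↔ (T.row i = 1 → ∃ b : T.Arc 1, b.left = i) := Iff.rfl
  rw [BoundaryGraph.extendedDepthRow, depth_faceLeft hμ, depth_faceRight hμ, hsrc]
  have hi := T.row_lt_three hμ i
  obtain h0 | h1 | h2 : T.row i = 0 ∨ T.row i = 1 ∨ T.row i = 2 := by omega
  · obtain ⟨a, rfl⟩ := exists_arc_left hμ.rowLen_one h0
    rw [cover_snd_succ_of_fst_left, ncard_cover_left_succ, h0]
    simp
  · obtain ⟨a, rfl⟩ := exists_arc_right h1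
    -- In the middle of an `m` the closing first arc and the opening second arc cancel. At an
    -- isolated right end the depth drops, and only the sink condition separates this case from the
    -- top row.
    by_cases hb : ∃ b : T.Arc 1, b.left = a.right
    · have h3 := ncard_cover_right a
      obtain ⟨b, hb⟩ := hb
      rw [h3, ← hb, ncard_cover_left_succ, hb, h1]
      have : (((T.cover 0 (a.right + 1)).ncard + ((T.cover 1 a.right).ncard + 1) : ℕ) : ℤ) -
          (((T.cover 0 (a.right + 1)).ncard + 1 + (T.cover 1 a.right).ncard : ℕ) : ℤ) = 0 := by
        push_cast
        ring
      simp only [this]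
      simp
    · push Not at hb
      rw [cover_snd_succ_of_fst_right a hb, ncard_cover_right, h1]
      have : (((T.cover 0 (a.right + 1)).ncard + (T.cover 1 a.right).ncard : ℕ) : ℤ) -
          (((T.cover 0 (a.right + 1)).ncard + 1 + (T.cover 1 a.right).ncard : ℕ) : ℤ) = -1 := by
        push_cast
        ring
      simp only [this]
      simp [hb]
  · obtain ⟨b, rfl⟩ := exists_arc_right h2
    rw [cover_fst_succ_of_snd_right, ncard_cover_right, h2]
    have : (((T.cover 0 b.right).ncard + (T.cover 1 (b.right + 1)).ncard : ℕ) : ℤ) -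
        (((T.cover 0 b.right).ncard + ((T.cover 1 (b.right + 1)).ncard + 1) : ℕ) : ℤ) = -1 := by
      push_cast
      ring
    simp only [this]
    simp

/-! #### Steps of a walk around a face -/

theorem faceStep_inner {h h' : T.ResolvedHalfEdge} {v : T.InnerVertex} {s : Slot}
    (hh : T.ResolvedEdge h h' ∨ T.ResolvedEdge h' h) (hr : T.resolvedRot (Sum.inr (v, s)) = h') :
    T.resolvedMDiagram.FaceStep (Sum.inl h) (Sum.inl (Sum.inr (v, s) : T.ResolvedHalfEdge)) := by
  refine ⟨Sum.inl h', .edge (G := T.resolvedMDiagram) h h' hh, ?_⟩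
  rw [← hr]
  exact .inner (G := T.resolvedMDiagram) (Sum.inr (v, s) : T.ResolvedHalfEdge) fun i e => by cases e

/-- A walk that reaches a boundary vertex continues along a segment of the line, so its face is not
interior. -/
theorem not_opp_bdry {f : T.resolvedMDiagram.Face} (hf : T.resolvedMDiagram.IsInteriorFace f)
    {h : T.ResolvedHalfEdge} {i : Fin μ.card}
    (hh : T.ResolvedEdge h (Sum.inl i) ∨ T.ResolvedEdge (Sum.inl i) h)
    (hhf : T.resolvedMDiagram.face (Sum.inl h) = f) : False := by
  refine hf (i.succ, false) ?_
  rw [← hhf]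
  exact (Quot.sound ⟨_, .edge (G := T.resolvedMDiagram) h _ hh, .right i⟩).symm

end StandardTableau

/-! ### Interior faces have at least six edges -/

namespace StandardTableau

variable {μ : YoungDiagram} {T : StandardTableau μ}

/-- The new edge of a resolved crossing, with the face to the right of the crossing on the left
side. -/
def WestEnd (T : StandardTableau μ) (c : T.Crossing) (h : T.ResolvedHalfEdge) : Prop :=
  c.fst.left < c.snd.left ∧ h = Sum.inr (InnerVertex.sink c, Slot.third) ∨
    ¬ c.fst.left < c.snd.left ∧ h = Sum.inr (InnerVertex.source c, Slot.third)

/-- The new edge of a resolved crossing, with the face to the left of the crossing on the left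
side. -/
def EastEnd (T : StandardTableau μ) (c : T.Crossing) (h : T.ResolvedHalfEdge) : Prop :=
  c.fst.left < c.snd.left ∧ h = Sum.inr (InnerVertex.source c, Slot.third) ∨
    ¬ c.fst.left < c.snd.left ∧ h = Sum.inr (InnerVertex.sink c, Slot.third)

theorem rot_eq_of_lt {c : T.Crossing} (hc : c.fst.left < c.snd.left) (s : Slot) :
    T.resolvedRot (Sum.inr (InnerVertex.sink c, s)) = Sum.inr (InnerVertex.sink c, s.prev) ∧
      T.resolvedRot (Sum.inr (InnerVertex.source c, s)) =
        Sum.inr (InnerVertex.source c, s.prev) := by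
  simp only [resolvedRot, crossingRot, if_pos hc, and_self]

theorem rot_eq_of_not_lt {c : T.Crossing} (hc : ¬ c.fst.left < c.snd.left) (s : Slot) :
    T.resolvedRot (Sum.inr (InnerVertex.sink c, s)) = Sum.inr (InnerVertex.sink c, s.next) ∧
      T.resolvedRot (Sum.inr (InnerVertex.source c, s)) =
        Sum.inr (InnerVertex.source c, s.next) := by
  simp only [resolvedRot, crossingRot, if_neg hc, and_self]

theorem WestEnd.unique {c c' : T.Crossing} {h : T.ResolvedHalfEdge} (h1 : T.WestEnd c h)
    (h2 : T.WestEnd c' h) : c = c' := by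
  rcases h1 with ⟨-, rfl⟩ | ⟨-, rfl⟩ <;> rcases h2 with ⟨-, e⟩ | ⟨-, e⟩ <;> cases e <;> rfl

theorem WestEnd.not_eastEnd {c c' : T.Crossing} {h : T.ResolvedHalfEdge} (h1 : T.WestEnd c h)
    (h2 : T.EastEnd c' h) : False := by
  rcases h1 with ⟨h3, rfl⟩ | ⟨h3, rfl⟩ <;> rcases h2 with ⟨h4, e⟩ | ⟨h4, e⟩ <;> cases e
  · exact h4 h3
  · exact h3 h4

theorem WestEnd.four_le_kind {c : T.Crossing} {h : T.ResolvedHalfEdge} (h1 : T.WestEnd c h) :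
    4 ≤ T.kind h := by
  rcases h1 with ⟨-, rfl⟩ | ⟨-, rfl⟩
  · exact (Nat.le_succ 4 : 4 ≤ 5)
  · exact (le_rfl : 4 ≤ 4)

/-! The steps of a walk around an interior face. -/

section Steps

variable {f : T.resolvedMDiagram.Face} {h : T.ResolvedHalfEdge} {a : T.Arc 0} {b : T.Arc 1}
  {c : T.Crossing} {t : Fin μ.card}

/-- `FstOut` and `SndIn` have the outside of their arc on the left, so they lie on the lower side of
the face. The orientation of the crossing reached decides between turning onto an arc of the other
kind and meeting a new edge at the right end. A `Y` gives another turn. -/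
theorem FstOut.faceStep (hf : T.resolvedMDiagram.IsInteriorFace f)
    (hhf : T.resolvedMDiagram.face (Sum.inl h) = f) (hh : T.FstOut a h t) :
    ∃ k : T.ResolvedHalfEdge, T.resolvedMDiagram.FaceStep (Sum.inl h) (Sum.inl k) ∧
      ((∃ b s, T.SndIn b k s) ∨ ∃ c : T.Crossing, ¬ c.fst.left < c.snd.left ∧ c.fst = a ∧
        t < c.posFst ∧ T.EastEnd c k) := by
  obtain ⟨h', t', hin, hlt, he⟩ := hh.exists_edge
  rcases hin with ⟨c, rfl⟩ | ⟨b, hb⟩ | hb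
  · by_cases hc : c.fst.left < c.snd.left
    · exact ⟨_, faceStep_inner (Or.inl he) (rot_eq_of_lt hc .second).1,
        Or.inl ⟨_, _, .cross c rfl⟩⟩
    · exact ⟨_, faceStep_inner (Or.inl he) (rot_eq_of_not_lt hc .third).1,
        Or.inr ⟨c, hc, rfl, hlt, Or.inr ⟨hc, rfl⟩⟩⟩
  · exact ⟨_, faceStep_inner (v := .tri b) (s := .second) (Or.inl he) rfl, Or.inl ⟨_, _, .endTri⟩⟩
  · exact (not_opp_bdry hf (Or.inl he) hhf).elim

theorem SndIn.faceStep (hf : T.resolvedMDiagram.IsInteriorFace f)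
    (hhf : T.resolvedMDiagram.face (Sum.inl h) = f) (hh : T.SndIn b h t) :
    ∃ k : T.ResolvedHalfEdge, T.resolvedMDiagram.FaceStep (Sum.inl h) (Sum.inl k) ∧
      ((∃ a s, T.FstOut a k s) ∨ ∃ c : T.Crossing, c.fst.left < c.snd.left ∧ c.snd = b ∧
        t < c.posSnd ∧ T.EastEnd c k) := by
  obtain ⟨h', t', hin, hlt, he⟩ := hh.exists_edge
  rcases hin with _ | ⟨c, rfl⟩
  · exact (not_opp_bdry hf (Or.inr he) hhf).elim
  · by_cases hc : c.fst.left < c.snd.left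
    · exact ⟨_, faceStep_inner (Or.inr he) (rot_eq_of_lt hc .third).2,
        Or.inr ⟨c, hc, rfl, hlt, Or.inl ⟨hc, rfl⟩⟩⟩
    · exact ⟨_, faceStep_inner (Or.inr he) (rot_eq_of_not_lt hc .first).2,
        Or.inl ⟨_, _, .cross c rfl⟩⟩

/-- `FstIn` and `SndOut` lie on the upper side, which is walked from right to left. The recorded
inequality of positions later bounds how often the walk can turn before the left end. -/
theorem FstIn.faceStep (hf : T.resolvedMDiagram.IsInteriorFace f)
    (hhf : T.resolvedMDiagram.face (Sum.inl h) = f) (hh : T.FstIn a h t) :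
    ∃ k : T.ResolvedHalfEdge, T.resolvedMDiagram.FaceStep (Sum.inl h) (Sum.inl k) ∧
      ((∃ c : T.Crossing, c.fst.left < c.snd.left ∧ c.fst = a ∧ c.posFst < t ∧
        T.SndOut c.snd k c.posSnd) ∨
      ∃ c : T.Crossing, ¬ c.fst.left < c.snd.left ∧ c.fst = a ∧ T.WestEnd c k) := by
  obtain ⟨h', t', hin, hlt, he⟩ := hh.exists_edge
  rcases hin with _ | ⟨c, rfl⟩
  · exact (not_opp_bdry hf (Or.inr he) hhf).elim
  · by_cases hc : c.fst.left < c.snd.left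
    · exact ⟨_, faceStep_inner (Or.inr he) (rot_eq_of_lt hc .second).2,
        Or.inl ⟨c, hc, rfl, hlt, .cross c rfl⟩⟩
    · exact ⟨_, faceStep_inner (Or.inr he) (rot_eq_of_not_lt hc .third).2,
        Or.inr ⟨c, hc, rfl, Or.inr ⟨hc, rfl⟩⟩⟩

theorem SndOut.faceStep (hf : T.resolvedMDiagram.IsInteriorFace f)
    (hhf : T.resolvedMDiagram.face (Sum.inl h) = f) (hh : T.SndOut b h t) :
    ∃ k : T.ResolvedHalfEdge, T.resolvedMDiagram.FaceStep (Sum.inl h) (Sum.inl k) ∧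
      ((∃ c : T.Crossing, ¬ c.fst.left < c.snd.left ∧ c.snd = b ∧ c.posSnd < t ∧
        T.FstIn c.fst k c.posFst) ∨
      ∃ c : T.Crossing, c.fst.left < c.snd.left ∧ c.snd = b ∧ T.WestEnd c k) := by
  obtain ⟨h', t', hin, hlt, he⟩ := hh.exists_edge
  rcases hin with ⟨c, rfl⟩ | _
  · by_cases hc : c.fst.left < c.snd.left
    · exact ⟨_, faceStep_inner (Or.inl he) (rot_eq_of_lt hc .third).1,
        Or.inr ⟨c, hc, rfl, Or.inl ⟨hc, rfl⟩⟩⟩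
    · exact ⟨_, faceStep_inner (Or.inl he) (rot_eq_of_not_lt hc .first).1,
        Or.inl ⟨c, hc, rfl, hlt, .cross c rfl⟩⟩
  · have hk : T.resolvedMDiagram.FaceStep (Sum.inl h)
        (Sum.inl (Sum.inr (.tri b, .third) : T.ResolvedHalfEdge)) :=
      faceStep_inner (Or.inl he) rfl
    exact (not_opp_bdry hf (Or.inr (.stem b)) (hhf ▸ (Quot.sound hk).symm)).elim

theorem WestEnd.faceStep (hh : T.WestEnd c h) :
    ∃ k : T.ResolvedHalfEdge, T.resolvedMDiagram.FaceStep (Sum.inl h) (Sum.inl k) ∧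
      (c.fst.left < c.snd.left ∧ T.FstOut c.fst k c.posFst ∨
        ¬ c.fst.left < c.snd.left ∧ T.SndIn c.snd k c.posSnd) := by
  rcases hh with ⟨hc, rfl⟩ | ⟨hc, rfl⟩
  · exact ⟨_, faceStep_inner (Or.inr (.resolve c)) (rot_eq_of_lt hc .first).2,
      Or.inl ⟨hc, .cross c rfl⟩⟩
  · exact ⟨_, faceStep_inner (Or.inl (.resolve c)) (rot_eq_of_not_lt hc .second).1,
      Or.inr ⟨hc, .cross c rfl⟩⟩

theorem EastEnd.faceStep (hh : T.EastEnd c h) :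
    ∃ k : T.ResolvedHalfEdge, T.resolvedMDiagram.FaceStep (Sum.inl h) (Sum.inl k) ∧
      (c.fst.left < c.snd.left ∧ T.FstIn c.fst k c.posFst ∨
        ¬ c.fst.left < c.snd.left ∧ T.SndOut c.snd k c.posSnd) := by
  rcases hh with ⟨hc, rfl⟩ | ⟨hc, rfl⟩
  · exact ⟨_, faceStep_inner (Or.inl (.resolve c)) (rot_eq_of_lt hc .first).1,
      Or.inl ⟨hc, .cross c rfl⟩⟩
  · exact ⟨_, faceStep_inner (Or.inr (.resolve c)) (rot_eq_of_not_lt hc .second).2,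
      Or.inr ⟨hc, .cross c rfl⟩⟩

/-- Every interior face has a crossing at its left end. -/
theorem exists_westEnd (hf : T.resolvedMDiagram.IsInteriorFace f)
    (hhf : T.resolvedMDiagram.face (Sum.inl h) = f) (htop : T.IsTop h) :
    ∃ c k, T.WestEnd c k ∧ T.resolvedMDiagram.face (Sum.inl k) = f := by
  rcases htop with ⟨a, t, hh⟩ | ⟨b, t, hh⟩
  · obtain ⟨k, hk, ⟨c, hc, -, -, hk'⟩ | ⟨c, -, -, hk'⟩⟩ := hh.faceStep hf hhf
    · have hkf : T.resolvedMDiagram.face (Sum.inl k) = f := hhf ▸ (Quot.sound hk).symm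
      obtain ⟨m, hm, ⟨c', hc', h1, h2, -⟩ | ⟨c', -, -, hm'⟩⟩ := hk'.faceStep hf hkf
      -- Two turns in a row on the upper side would make the first arcs of `c` and `c'` cross.
      · exfalso
        have h3 := c.interlace
        have h4 := c'.interlace
        have h5 := Arc.noncrossing c.fst c'.fst
        rw [Fin.lt_def, Crossing.posSnd_val, Crossing.posSnd_val] at h2
        rw [Fin.lt_def] at hc hc'
        rw [h1] at h2 h4 hc'
        split_ifs at h2 <;> omega
      · exact ⟨c', m, hm', hkf ▸ (Quot.sound hm).symm⟩
    · exact ⟨c, k, hk', hhf ▸ (Quot.sound hk).symm⟩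
  · obtain ⟨k, hk, ⟨c, hc, -, -, hk'⟩ | ⟨c, -, -, hk'⟩⟩ := hh.faceStep hf hhf
    · have hkf : T.resolvedMDiagram.face (Sum.inl k) = f := hhf ▸ (Quot.sound hk).symm
      obtain ⟨m, hm, ⟨c', hc', h1, h2, -⟩ | ⟨c', -, -, hm'⟩⟩ := hk'.faceStep hf hkf
      -- Here the second arcs of `c` and `c'` would cross.
      · exfalso
        have h3 := c.interlace
        have h4 := c'.interlace
        have h5 := Arc.noncrossing c.snd c'.snd
        rw [Fin.lt_def, Crossing.posFst_val, Crossing.posFst_val] at h2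
        rw [Fin.lt_def] at hc hc'
        rw [h1] at h2 h4 hc'
        split_ifs at h2
        omega
      · exact ⟨c', m, hm', hkf ▸ (Quot.sound hm).symm⟩
    · exact ⟨c, k, hk', hhf ▸ (Quot.sound hk).symm⟩

end Steps

/-- A half-edge that is not the one at the left end of the face to the right of `c`. -/
def NotWestEnd (T : StandardTableau μ) (c : T.Crossing) (h : T.ResolvedHalfEdge) : Prop :=
  T.kind h < 4 ∨ (∃ c', T.EastEnd c' h) ∨ ∃ c', c' ≠ c ∧ T.WestEnd c' h

theorem NotWestEnd.not_westEnd {c : T.Crossing} {h : T.ResolvedHalfEdge} (h1 : T.NotWestEnd c h) :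
    ¬ T.WestEnd c h := by
  intro h2
  rcases h1 with h1 | ⟨c', h1⟩ | ⟨c', hne, h1⟩
  · exact absurd h2.four_le_kind (not_le.2 h1)
  · exact h2.not_eastEnd h1
  · exact hne (h1.unique h2)

/-! ### Walking around an interior face from its left end -/

section Walk

variable {f : T.resolvedMDiagram.Face} {h : T.ResolvedHalfEdge} {a : T.Arc 0} {b : T.Arc 1}
  {c : T.Crossing} {t : Fin μ.card}

theorem FstOut.notWestEnd (c : T.Crossing) (hh : T.FstOut a h t) : T.NotWestEnd c h :=
  Or.inl (by rw [hh.kind_eq]; omega)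

theorem FstIn.notWestEnd (c : T.Crossing) (hh : T.FstIn a h t) : T.NotWestEnd c h :=
  Or.inl (by rw [hh.kind_eq]; omega)

theorem SndOut.notWestEnd (c : T.Crossing) (hh : T.SndOut b h t) : T.NotWestEnd c h :=
  Or.inl (by rw [hh.kind_eq]; omega)

theorem SndIn.notWestEnd (c : T.Crossing) (hh : T.SndIn b h t) : T.NotWestEnd c h :=
  Or.inl (by rw [hh.kind_eq]; omega)

theorem EastEnd.notWestEnd {c' : T.Crossing} (c : T.Crossing) (hh : T.EastEnd c' h) :
    T.NotWestEnd c h := Or.inr (Or.inl ⟨_, hh⟩)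

/-- The step after the right end of a face does not lead to the left end. -/
theorem EastEnd.exists_step {c' : T.Crossing} (c : T.Crossing) (hh : T.EastEnd c' h) :
    ∃ k : T.ResolvedHalfEdge, T.resolvedMDiagram.FaceStep (Sum.inl h) (Sum.inl k) ∧
      T.NotWestEnd c k := by
  obtain ⟨k, hk, ⟨-, hk'⟩ | ⟨-, hk'⟩⟩ := hh.faceStep
  · exact ⟨k, hk, hk'.notWestEnd c⟩
  · exact ⟨k, hk, hk'.notWestEnd c⟩

/-- After an edge on the lower side of an interior face it takes at least three steps to the left
end. -/
theorem exists_two_steps (hf : T.resolvedMDiagram.IsInteriorFace f)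
    (hhf : T.resolvedMDiagram.face (Sum.inl h) = f) (c : T.Crossing)
    (hh : (∃ a t, T.FstOut a h t) ∨ ∃ b t, T.SndIn b h t) :
    ∃ k l : T.ResolvedHalfEdge, T.resolvedMDiagram.FaceStep (Sum.inl h) (Sum.inl k) ∧
      T.resolvedMDiagram.FaceStep (Sum.inl k) (Sum.inl l) ∧ T.NotWestEnd c k ∧
      T.NotWestEnd c l := by
  rcases hh with ⟨a, t, hh⟩ | ⟨b, t, hh⟩
  · obtain ⟨k, hk, ⟨b, s, hk'⟩ | ⟨c', -, -, -, hk'⟩⟩ := hh.faceStep hf hhf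
    · obtain ⟨l, hl, ⟨a, s, hl'⟩ | ⟨c', -, -, -, hl'⟩⟩ :=
        hk'.faceStep hf (hhf ▸ (Quot.sound hk).symm)
      · exact ⟨k, l, hk, hl, hk'.notWestEnd c, hl'.notWestEnd c⟩
      · exact ⟨k, l, hk, hl, hk'.notWestEnd c, hl'.notWestEnd c⟩
    · obtain ⟨l, hl, hl'⟩ := hk'.exists_step c
      exact ⟨k, l, hk, hl, hk'.notWestEnd c, hl'⟩
  · obtain ⟨k, hk, ⟨b, s, hk'⟩ | ⟨c', -, -, -, hk'⟩⟩ := hh.faceStep hf hhf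
    · obtain ⟨l, hl, ⟨a, s, hl'⟩ | ⟨c', -, -, -, hl'⟩⟩ :=
        hk'.faceStep hf (hhf ▸ (Quot.sound hk).symm)
      · exact ⟨k, l, hk, hl, hk'.notWestEnd c, hl'.notWestEnd c⟩
      · exact ⟨k, l, hk, hl, hk'.notWestEnd c, hl'.notWestEnd c⟩
    · obtain ⟨l, hl, hl'⟩ := hk'.exists_step c
      exact ⟨k, l, hk, hl, hk'.notWestEnd c, hl'⟩

/-- The step after the left end of a face does not lead to a left end. -/
theorem WestEnd.exists_step {c' : T.Crossing} (c : T.Crossing) (hh : T.WestEnd c' h) :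
    ∃ k : T.ResolvedHalfEdge, T.resolvedMDiagram.FaceStep (Sum.inl h) (Sum.inl k) ∧
      T.NotWestEnd c k := by
  obtain ⟨k, hk, ⟨-, hk'⟩ | ⟨-, hk'⟩⟩ := hh.faceStep
  · exact ⟨k, hk, hk'.notWestEnd c⟩
  · exact ⟨k, hk, hk'.notWestEnd c⟩

/-- A first arc on the upper side leads only to left ends whose crossing has the orientation
opposite to that of `c`. -/
theorem FstIn.exists_step (hf : T.resolvedMDiagram.IsInteriorFace f)
    (hhf : T.resolvedMDiagram.face (Sum.inl h) = f) (hc : c.fst.left < c.snd.left)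
    (hh : T.FstIn a h t) :
    ∃ k : T.ResolvedHalfEdge, T.resolvedMDiagram.FaceStep (Sum.inl h) (Sum.inl k) ∧
      T.NotWestEnd c k := by
  obtain ⟨k, hk, ⟨c', -, -, -, hk'⟩ | ⟨c', hc', -, hk'⟩⟩ := hh.faceStep hf hhf
  · exact ⟨k, hk, hk'.notWestEnd c⟩
  · exact ⟨k, hk, Or.inr (Or.inr ⟨c', fun e => hc' (e ▸ hc), hk'⟩)⟩

theorem SndOut.exists_step (hf : T.resolvedMDiagram.IsInteriorFace f)
    (hhf : T.resolvedMDiagram.face (Sum.inl h) = f) (hc : ¬ c.fst.left < c.snd.left)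
    (hh : T.SndOut b h t) :
    ∃ k : T.ResolvedHalfEdge, T.resolvedMDiagram.FaceStep (Sum.inl h) (Sum.inl k) ∧
      T.NotWestEnd c k := by
  obtain ⟨k, hk, ⟨c', -, -, -, hk'⟩ | ⟨c', hc', -, hk'⟩⟩ := hh.faceStep hf hhf
  · exact ⟨k, hk, hk'.notWestEnd c⟩
  · exact ⟨k, hk, Or.inr (Or.inr ⟨c', fun e => hc (e ▸ hc'), hk'⟩)⟩

/-- The first five steps from the left end of an interior face do not lead back to it. -/
theorem WestEnd.exists_five_steps (hf : T.resolvedMDiagram.IsInteriorFace f)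
    (hhf : T.resolvedMDiagram.face (Sum.inl h) = f) (hh : T.WestEnd c h) :
    ∃ k₁ k₂ k₃ k₄ k₅ : T.ResolvedHalfEdge,
      (T.resolvedMDiagram.FaceStep (Sum.inl h) (Sum.inl k₁) ∧
      T.resolvedMDiagram.FaceStep (Sum.inl k₁) (Sum.inl k₂) ∧
      T.resolvedMDiagram.FaceStep (Sum.inl k₂) (Sum.inl k₃) ∧
      T.resolvedMDiagram.FaceStep (Sum.inl k₃) (Sum.inl k₄) ∧
      T.resolvedMDiagram.FaceStep (Sum.inl k₄) (Sum.inl k₅)) ∧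
      T.NotWestEnd c k₁ ∧ T.NotWestEnd c k₂ ∧ T.NotWestEnd c k₃ ∧ T.NotWestEnd c k₄ ∧
      T.NotWestEnd c k₅ := by
  have next : ∀ {h k : T.ResolvedHalfEdge}, T.resolvedMDiagram.face (Sum.inl h) = f →
      T.resolvedMDiagram.FaceStep (Sum.inl h) (Sum.inl k) →
      T.resolvedMDiagram.face (Sum.inl k) = f := fun h1 h2 => h1 ▸ (Quot.sound h2).symm
  obtain ⟨k₁, s₁, ⟨hc, h₁⟩ | ⟨hc, h₁⟩⟩ := hh.faceStep
  · have f₁ := next hhf s₁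
    -- The cases depend on whether the lower side has one edge, two edges or at least three. A short
    -- lower side is compensated by the upper side.
    obtain ⟨k₂, s₂, ⟨_, _, h₂⟩ | ⟨c₂, hc₂, e₂, hlt, h₂⟩⟩ := h₁.faceStep hf f₁
    · have f₂ := next f₁ s₂
      obtain ⟨k₃, s₃, ⟨_, _, h₃⟩ | ⟨c₃, hc₃, -, -, h₃⟩⟩ := h₂.faceStep hf f₂
      · obtain ⟨k₄, k₅, s₄, s₅, h₄, h₅⟩ :=
          exists_two_steps hf (next f₂ s₃) c (Or.inl ⟨_, _, h₃⟩)
        exact ⟨k₁, k₂, k₃, k₄, k₅, ⟨s₁, s₂, s₃, s₄, s₅⟩, h₁.notWestEnd c, h₂.notWestEnd c,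
          h₃.notWestEnd c, h₄, h₅⟩
      · obtain ⟨k₄, s₄, ⟨-, h₄⟩ | ⟨hc₃', -⟩⟩ := h₃.faceStep
        · obtain ⟨k₅, s₅, h₅⟩ := h₄.exists_step hf (next (next f₂ s₃) s₄) hc
          exact ⟨k₁, k₂, k₃, k₄, k₅, ⟨s₁, s₂, s₃, s₄, s₅⟩, h₁.notWestEnd c, h₂.notWestEnd c,
            h₃.notWestEnd c, h₄.notWestEnd c, h₅⟩
        · exact absurd hc₃ hc₃'
    · obtain ⟨k₃, s₃, ⟨hc₂', -⟩ | ⟨-, h₃⟩⟩ := h₂.faceStep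
      · exact absurd hc₂' hc₂
      · have f₃ := next (next f₁ s₂) s₃
        obtain ⟨k₄, s₄, ⟨_, -, -, -, h₄⟩ | ⟨c₄, -, e₄, h₄⟩⟩ := h₃.faceStep hf f₃
        · obtain ⟨k₅, s₅, h₅⟩ := h₄.exists_step hf (next f₃ s₄) hc
          exact ⟨k₁, k₂, k₃, k₄, k₅, ⟨s₁, s₂, s₃, s₄, s₅⟩, h₁.notWestEnd c, h₂.notWestEnd c,
            h₃.notWestEnd c, h₄.notWestEnd c, h₅⟩
        · obtain ⟨k₅, s₅, h₅⟩ := h₄.exists_step c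
          refine ⟨k₁, k₂, k₃, k₄, k₅, ⟨s₁, s₂, s₃, s₄, s₅⟩, h₁.notWestEnd c, h₂.notWestEnd c,
            h₃.notWestEnd c, Or.inr (Or.inr ⟨c₄, ?_, h₄⟩), h₅⟩
          -- A return after four edges would make `c` and `c₂` crossings of the same two arcs, hence
          -- equal, although `c₂` lies strictly farther along the first arc.
          rintro rfl
          exact hlt.ne (congrArg Crossing.posFst (Crossing.ext e₂.symm e₄))
  · have f₁ := next hhf s₁
    obtain ⟨k₂, s₂, ⟨_, _, h₂⟩ | ⟨c₂, hc₂, e₂, hlt, h₂⟩⟩ := h₁.faceStep hf f₁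
    · have f₂ := next f₁ s₂
      obtain ⟨k₃, s₃, ⟨_, _, h₃⟩ | ⟨c₃, hc₃, -, -, h₃⟩⟩ := h₂.faceStep hf f₂
      · obtain ⟨k₄, k₅, s₄, s₅, h₄, h₅⟩ :=
          exists_two_steps hf (next f₂ s₃) c (Or.inr ⟨_, _, h₃⟩)
        exact ⟨k₁, k₂, k₃, k₄, k₅, ⟨s₁, s₂, s₃, s₄, s₅⟩, h₁.notWestEnd c, h₂.notWestEnd c,
          h₃.notWestEnd c, h₄, h₅⟩
      · obtain ⟨k₄, s₄, ⟨hc₃', -⟩ | ⟨-, h₄⟩⟩ := h₃.faceStep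
        · exact absurd hc₃' hc₃
        · obtain ⟨k₅, s₅, h₅⟩ := h₄.exists_step hf (next (next f₂ s₃) s₄) hc
          exact ⟨k₁, k₂, k₃, k₄, k₅, ⟨s₁, s₂, s₃, s₄, s₅⟩, h₁.notWestEnd c, h₂.notWestEnd c,
            h₃.notWestEnd c, h₄.notWestEnd c, h₅⟩
    · obtain ⟨k₃, s₃, ⟨-, h₃⟩ | ⟨hc₂', -⟩⟩ := h₂.faceStep
      · have f₃ := next (next f₁ s₂) s₃
        obtain ⟨k₄, s₄, ⟨_, -, -, -, h₄⟩ | ⟨c₄, -, e₄, h₄⟩⟩ := h₃.faceStep hf f₃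
        · obtain ⟨k₅, s₅, h₅⟩ := h₄.exists_step hf (next f₃ s₄) hc
          exact ⟨k₁, k₂, k₃, k₄, k₅, ⟨s₁, s₂, s₃, s₄, s₅⟩, h₁.notWestEnd c, h₂.notWestEnd c,
            h₃.notWestEnd c, h₄.notWestEnd c, h₅⟩
        · obtain ⟨k₅, s₅, h₅⟩ := h₄.exists_step c
          refine ⟨k₁, k₂, k₃, k₄, k₅, ⟨s₁, s₂, s₃, s₄, s₅⟩, h₁.notWestEnd c, h₂.notWestEnd c,
            h₃.notWestEnd c, Or.inr (Or.inr ⟨c₄, ?_, h₄⟩), h₅⟩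
          rintro rfl
          exact hlt.ne (congrArg Crossing.posSnd (Crossing.ext e₄ e₂.symm))
      · exact absurd hc₂ hc₂'

end Walk

/-- An orbit of a permutation that does not close up in the first `m - 1` steps has at least `m`
elements. -/
theorem _root_.le_card_of_pow_ne {D : Type*} (φ : Equiv.Perm D) (d : D) (m : ℕ) (p : D → Prop)
    [Finite {e // p e}] (hp : ∀ e, p e → p (φ e)) (hd : p d)
    (hne : ∀ j, 0 < j → j < m → (φ ^ j) d ≠ d) : m ≤ Nat.card {e // p e} := by
  have hpow : ∀ j, p ((φ ^ j) d) := by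
    intro j
    induction j with
    | zero => exact hd
    | succ j ih =>
      rw [pow_succ', Equiv.Perm.mul_apply]
      exact hp _ ih
  have hlt : ∀ i j : Fin m, i < j → (φ ^ (i : ℕ)) d ≠ (φ ^ (j : ℕ)) d := by
    intro i j hij h
    have hij : (i : ℕ) < j := hij
    obtain ⟨l, hl⟩ := Nat.exists_eq_add_of_lt hij
    rw [hl, add_assoc, pow_add, Equiv.Perm.mul_apply] at h
    exact hne (l + 1) (Nat.succ_pos _) (by omega) ((φ ^ (i : ℕ)).injective h).symm
  have hinj : Function.Injective fun j : Fin m => (⟨_, hpow j⟩ : {e // p e}) := by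
    intro i j h
    have h := congrArg Subtype.val h
    rcases lt_trichotomy i j with hij | hij | hij
    · exact absurd h (hlt i j hij)
    · exact hij
    · exact absurd h.symm (hlt j i hij)
  simpa using Nat.card_le_card_of_injective _ hinj

/-- Every interior face of a resolved diagram has at least six edges. -/
theorem six_le_card (hμ : IsThreeRow μ) {f : T.resolvedMDiagram.Face}
    (hf : T.resolvedMDiagram.IsInteriorFace f) :
    6 ≤ Nat.card {d : T.resolvedMDiagram.Dart // T.resolvedMDiagram.face d = f} := by
  have := (T.isMap hμ).finite_dart
  have hstep : ∀ {d e : T.resolvedMDiagram.Dart}, T.resolvedMDiagram.FaceStep d e →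
      (T.isMap hμ).facePerm d = e := fun h => ((T.isMap hμ).faceStep_iff _ _).1 h
  rcases exists_top_of_face hμ f with rfl | rfl | ⟨h₀, htop, hf₀⟩
  · exact absurd rfl (hf (0, true))
  · exact absurd rfl (hf (0, false))
  · obtain ⟨c, h, hh, hhf⟩ := exists_westEnd hf hf₀.symm htop
    obtain ⟨k₁, k₂, k₃, k₄, k₅, ⟨s₁, s₂, s₃, s₄, s₅⟩, h₁, h₂, h₃, h₄, h₅⟩ :=
      hh.exists_five_steps hf hhf
    have key : ∀ {k : T.ResolvedHalfEdge}, T.NotWestEnd c k →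
        (Sum.inl k : T.resolvedMDiagram.Dart) ≠ Sum.inl h := by
      intro k hk e
      exact hk.not_westEnd (Sum.inl_injective e ▸ hh)
    refine le_card_of_pow_ne (T.isMap hμ).facePerm (Sum.inl h) 6 _ (fun e he => ?_) hhf
      fun j hj hj' => ?_
    · exact he ▸ (Quot.sound (((T.isMap hμ).faceStep_iff _ _).2 rfl)).symm
    · have e₁ : ((T.isMap hμ).facePerm ^ 1) (Sum.inl h) = Sum.inl k₁ := hstep s₁
      have e₂ : ((T.isMap hμ).facePerm ^ 2) (Sum.inl h) = Sum.inl k₂ :=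
        (congrArg _ e₁).trans (hstep s₂)
      have e₃ : ((T.isMap hμ).facePerm ^ 3) (Sum.inl h) = Sum.inl k₃ :=
        (congrArg (T.isMap hμ).facePerm e₂).trans (hstep s₃)
      have e₄ : ((T.isMap hμ).facePerm ^ 4) (Sum.inl h) = Sum.inl k₄ :=
        (congrArg (T.isMap hμ).facePerm e₃).trans (hstep s₄)
      have e₅ : ((T.isMap hμ).facePerm ^ 5) (Sum.inl h) = Sum.inl k₅ :=
        (congrArg (T.isMap hμ).facePerm e₄).trans (hstep s₅)
      obtain rfl | rfl | rfl | rfl | rfl : j = 1 ∨ j = 2 ∨ j = 3 ∨ j = 4 ∨ j = 5 := by omega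
      · exact fun e => key h₁ (e₁.symm.trans e)
      · exact fun e => key h₂ (e₂.symm.trans e)
      · exact fun e => key h₃ (e₃.symm.trans e)
      · exact fun e => key h₄ (e₄.symm.trans e)
      · exact fun e => key h₅ (e₅.symm.trans e)

theorem isIrreducibleWeb (hμ : IsThreeRow μ) (T : StandardTableau μ) :
    T.resolvedMDiagram.IsIrreducibleWeb where
  isWeb := T.isWeb hμ
  nonelliptic _ hf := six_le_card hμ hf

end StandardTableau

/-! ### Invariance under isotopy -/

namespace BoundaryGraph

variable {N : ℕ} {G G' : BoundaryGraph N}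

/-- A bijection of half-edges as a map of darts. -/
def dartEquiv (e : G.HalfEdge ≃ G'.HalfEdge) : G.Dart ≃ G'.Dart := Equiv.sumCongr e (Equiv.refl _)

theorem RotStep.map {e : G.HalfEdge ≃ G'.HalfEdge} (h1 : ∀ h, e (G.rot h) = G'.rot (e h))
    (h3 : ∀ i, e (G.bdry i) = G'.bdry i) {d d' : G.Dart} (h : G.RotStep d d') :
    G'.RotStep (dartEquiv e d) (dartEquiv e d') := by
  rcases h with ⟨h, hh⟩ | i | i | i | _ | _
  · have := RotStep.inner (G := G') (e h) fun i => by
      rw [← h3]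
      exact e.injective.ne (hh i)
    rwa [← h1] at this
  · have := RotStep.up (G := G') i
    rwa [← h3] at this
  · exact RotStep.left i
  · have := RotStep.right (G := G') i
    rwa [← h3] at this
  · exact RotStep.inftyFirst
  · exact RotStep.inftyLast

theorem Link.map {e : G.HalfEdge ≃ G'.HalfEdge} (h2 : ∀ h h', G.opp h h' ↔ G'.opp (e h) (e h'))
    {d d' : G.Dart} (h : G.Link d d') : G'.Link (dartEquiv e d) (dartEquiv e d') := by
  rcases h with ⟨h, h', hh⟩ | ⟨p, b⟩
  · exact Link.edge (G := G') _ _ ((h2 _ _).1 hh)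
  · exact Link.segment p b

/-- An isotopy maps faces to faces. -/
theorem Isotopic.exists_face_map (h : G.Isotopic G') : ∃ e : G.HalfEdge ≃ G'.HalfEdge,
    ∃ φ : G.Face ≃ G'.Face, (∀ d, φ (G.face d) = G'.face (dartEquiv e d)) ∧
      (∀ h h', G.opp h h' ↔ G'.opp (e h) (e h')) ∧ (∀ i, e (G.bdry i) = G'.bdry i) ∧
      ∀ h, G.out h ↔ G'.out (e h) := by
  obtain ⟨e, h1, h2, h3, h4⟩ := h
  have h1' : ∀ h, e.symm (G'.rot h) = G.rot (e.symm h) := fun h => by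
    rw [Equiv.symm_apply_eq, h1, Equiv.apply_symm_apply]
  have h2' : ∀ h h', G'.opp h h' ↔ G.opp (e.symm h) (e.symm h') := fun h h' => by
    rw [h2, Equiv.apply_symm_apply, Equiv.apply_symm_apply]
  have h3' : ∀ i, e.symm (G'.bdry i) = G.bdry i := fun i => by rw [Equiv.symm_apply_eq, h3]
  refine ⟨e, Quot.congr (dartEquiv e) fun d d' => ⟨?_, ?_⟩, fun d => rfl, h2, h3, h4⟩
  · rintro ⟨k, hk1, hk2⟩
    exact ⟨_, hk1.map h2, hk2.map h1 h3⟩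
  · rintro ⟨k, hk1, hk2⟩
    have hinv : ∀ d, dartEquiv e.symm (dartEquiv e d) = d := fun d => by
      rcases d with d | d
      · exact congrArg Sum.inl (e.symm_apply_apply d)
      · rfl
    have l := hk1.map h2'
    have r := hk2.map h1' h3'
    rw [hinv] at l r
    exact ⟨_, l, r⟩

/-- Walks are transported in both directions. Unreachable pairs are treated apart because their
distance is `0` by convention. -/
theorem _root_.SimpleGraph.Iso.dist_eq {V W : Type*} {H : SimpleGraph V} {K : SimpleGraph W}
    (φ : H ≃g K) (u v : V) : K.dist (φ u) (φ v) = H.dist u v := by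
  by_cases h : H.Reachable u v
  · refine le_antisymm ?_ ?_
    · obtain ⟨w, hw⟩ := h.exists_walk_length_eq_dist
      rw [← hw, ← SimpleGraph.Walk.length_map φ.toHom w]
      exact SimpleGraph.dist_le _
    · obtain ⟨w, hw⟩ := (φ.reachable_iff.2 h).exists_walk_length_eq_dist
      rw [← hw, ← SimpleGraph.Walk.length_map φ.symm.toHom w]
      simpa using SimpleGraph.dist_le (w.map φ.symm.toHom)
  · rw [SimpleGraph.dist_eq_zero_of_not_reachable h,
      SimpleGraph.dist_eq_zero_of_not_reachable fun h' => h (φ.reachable_iff.1 h')]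

/-- An isotopy induces an isomorphism of dual graphs that respects the unbounded face, the faces
beside each boundary vertex and the sources. The row depends on nothing else. -/
theorem Isotopic.extendedDepthRow_eq (h : G.Isotopic G') (i : Fin N) :
    G.extendedDepthRow i = G'.extendedDepthRow i := by
  obtain ⟨e, φ, hφ, h2, h3, h4⟩ := h.exists_face_map
  let ψ : G.dualGraph ≃g G'.dualGraph :=
    { toEquiv := φ
      map_rel_iff' := by
        intro f g
        have key : ∀ f g, (∃ h h', G'.opp h h' ∧ G'.face (Sum.inl h) = φ f ∧
            G'.face (Sum.inl h') = φ g) ↔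
            ∃ h h', G.opp h h' ∧ G.face (Sum.inl h) = f ∧ G.face (Sum.inl h') = g := by
          intro f g
          constructor
          · rintro ⟨h, h', hh, hf, hg⟩
            obtain ⟨h, rfl⟩ := e.surjective h
            obtain ⟨h', rfl⟩ := e.surjective h'
            exact ⟨h, h', (h2 _ _).2 hh, φ.injective ((hφ _).trans hf),
              φ.injective ((hφ _).trans hg)⟩
          · rintro ⟨h, h', hh, rfl, rfl⟩
            exact ⟨e h, e h', (h2 _ _).1 hh, (hφ (Sum.inl h)).symm, (hφ (Sum.inl h')).symm⟩
        simp only [dualGraph, SimpleGraph.fromRel_adj, key, ne_eq, φ.injective.eq_iff] }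
  have hd : ∀ d, G'.depth (G'.face (dartEquiv e d)) = G.depth (G.face d) := by
    intro d
    rw [← hφ]
    have hu : G'.unboundedFace = ψ G.unboundedFace := (hφ (Sum.inr (0, false))).symm
    rw [depth, depth, hu]
    exact SimpleGraph.Iso.dist_eq ψ _ _
  have hl : G'.depth (G'.faceLeft i) = G.depth (G.faceLeft i) := by
    rw [faceLeft, ← h3]
    exact hd (Sum.inl (G.bdry i))
  have hr : G'.depth (G'.faceRight i) = G.depth (G.faceRight i) := hd (Sum.inr (i.succ, false))
  have hs : G.IsSource i = G'.IsSource i := by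
    rw [IsSource, IsSource, ← h3]
    exact propext (h4 _)
  rw [extendedDepthRow, extendedDepthRow, hl, hr, hs]

end BoundaryGraph

/-! ### Sources and sinks, and the main theorem -/

namespace StandardTableau

variable {μ : YoungDiagram}

/-- The sinks are the middle-row numbers that are not on a second arc. -/
theorem card_sink_add (T : StandardTableau μ) :
    Nat.card {i // ¬ T.resolvedMDiagram.IsSource i} + μ.rowLen 2 = μ.rowLen 1 := by
  classical
  have h2 := T.card_arc 1
  rw [show μ.rowLen 2 = Nat.card (T.Arc 1) from h2.symm, ← T.card_row 1, ← Nat.card_sum]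
  refine Nat.card_congr (Equiv.ofBijective
    (Sum.elim (fun i => ⟨i.1, by_contra fun h => i.2 fun h' => absurd h' h⟩)
      fun b => ⟨b.left, b.row_left⟩) ⟨?_, ?_⟩)
  · rintro (⟨i, hi⟩ | b) (⟨j, hj⟩ | b') h <;> have h := congrArg Subtype.val h
    · exact congrArg Sum.inl (Subtype.ext h)
    · exact absurd (fun _ => ⟨b', h.symm⟩) hi
    · exact absurd (fun _ => ⟨b, h⟩) hj
    · exact congrArg Sum.inr (Arc.left_injective h)
  · rintro ⟨i, hi⟩
    by_cases hb : ∃ b : T.Arc 1, b.left = i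
    · obtain ⟨b, rfl⟩ := hb
      exact ⟨Sum.inr b, rfl⟩
    · exact ⟨Sum.inl ⟨i, fun h => hb (h hi)⟩, rfl⟩

theorem card_source_add_card_sink (T : StandardTableau μ) :
    Nat.card {i // T.resolvedMDiagram.IsSource i} +
      Nat.card {i // ¬ T.resolvedMDiagram.IsSource i} = μ.card := by
  classical
  rw [← Nat.card_sum, Nat.card_congr (Equiv.sumCompl fun i => T.resolvedMDiagram.IsSource i),
    Nat.card_fin]

end StandardTableau

theorem BoundaryGraph.Isotopic.isExtendedDepthTableau {μ : YoungDiagram} (hμ : IsThreeRow μ)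
    {G : BoundaryGraph μ.card} {T : StandardTableau μ} (h : G.Isotopic T.resolvedMDiagram) :
    G.IsExtendedDepthTableau T := fun i =>
  (h.extendedDepthRow_eq i).trans (StandardTableau.isExtendedDepthTableau hμ T i)

theorem BoundaryGraph.IsExtendedDepthTableau.unique {μ : YoungDiagram}
    {G : BoundaryGraph μ.card} {T T' : StandardTableau μ} (h : G.IsExtendedDepthTableau T)
    (h' : G.IsExtendedDepthTableau T') : T = T' :=
  StandardTableau.eq_of_row_eq fun i => Option.some_injective _ ((h i).symm.trans (h' i))

theorem mainTheorem5 (n k : ℕ) (hnk : n ≤ k) :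
    -- resolved diagrams are irreducible webs with `3n + (k - n)` sources and `k - n` sinks
    (∀ T : StandardTableau (shapeNKK n k hnk),
      T.resolvedMDiagram.IsIrreducibleWeb ∧
      Nat.card {i // T.resolvedMDiagram.IsSource i} = 3 * n + (k - n) ∧
      Nat.card {i // ¬ T.resolvedMDiagram.IsSource i} = k - n) ∧
    -- the extended depth map is well defined on the irreducible webs that are resolved diagrams
    (∀ G : BoundaryGraph (shapeNKK n k hnk).card, G.IsIrreducibleWeb →
      (∃ T : StandardTableau (shapeNKK n k hnk), G.Isotopic T.resolvedMDiagram) →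
      ∃! T : StandardTableau (shapeNKK n k hnk), G.IsExtendedDepthTableau T) ∧
    -- on these webs it inverts the map from tableaux to resolved diagrams, on both sides
    (∀ T : StandardTableau (shapeNKK n k hnk), ∀ G : BoundaryGraph (shapeNKK n k hnk).card,
      G.IsIrreducibleWeb → G.Isotopic T.resolvedMDiagram → G.IsExtendedDepthTableau T) ∧
    (∀ T : StandardTableau (shapeNKK n k hnk), ∀ G : BoundaryGraph (shapeNKK n k hnk).card,
      G.IsIrreducibleWeb →
      (∃ T' : StandardTableau (shapeNKK n k hnk), G.Isotopic T'.resolvedMDiagram) →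
      G.IsExtendedDepthTableau T → G.Isotopic T.resolvedMDiagram) := by
  have hμ := isThreeRow_shapeNKK hnk
  refine ⟨fun T => ⟨T.isIrreducibleWeb hμ, ?_⟩, ?_, fun T G _ h => h.isExtendedDepthTableau hμ, ?_⟩
  · obtain ⟨h0, h1, h2⟩ := rowLen_shapeNKK hnk
    have h3 := T.card_sink_add
    have h4 := T.card_source_add_card_sink
    have h5 := T.card_eq_rowLen hμ
    rw [h1, h2] at h3
    rw [h0, h1, h2] at h5
    omega
  · rintro G - ⟨T, h⟩
    exact ⟨T, h.isExtendedDepthTableau hμ, fun T' h' => h'.unique (h.isExtendedDepthTableau hμ)⟩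
  · rintro T G - ⟨T', h⟩ hT
    -- The depth tableau of `G` is already known to be `T'`, so `T = T'` and the given isotopy is
    -- the required one.
    rwa [hT.unique (h.isExtendedDepthTableau hμ)]
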